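/- **Theorem 2.** *Problem.* Let $\mathcal N=\{1,\dots,N\}$ be a set of agents. Agent $i$ has decision $x_i\in\mathbb R^{n_i}$, local feasible set $\mathcal X_i\subseteq\mathbb R^{n_i}$, matrix $A_i\in\mathbb R^{l\times n_i}$ and objective $J_i:\mathbb R^{n_i}\times\mathbb R^l\to\mathbb R\cup\{+\infty\}$ (an objective defined only on $\mathcal X_i\times\mathbb R^l$ is extended by $+\infty$); let $c\in\mathbb R^l$ and $s_i(x)=\sum_{j\ne i}A_jx_j$. The problem is $$\min\ J(x)=\sum_{i}J_i(x_i,s_i(x))\quad\text{s.t. } x_i\in\mathcal X_i\ (i\in\mathcal N),\quad \sum_iA_ix_i\le c. \tag{P}$$ *Assumptions.* 1. Each $J_i$ is closed, convex and proper. 2. Each $\mathcal X_i$ is nonempty, closed and convex, and Slater's condition holds: there is $\bar x$ with $\bar x_i\in\mathcal X_i$ and $\sum_iA_i\bar x_i<c$ in every coordinate such that, for every $i$, $(\bar x_i,s_i(\bar x))\in\operatorname{ri}\operatorname{dom}J_i$ and, unless $\operatorname{dom}J_i\subseteq\mathcal X_i\times\mathbb R^l$, also $\bar x_i\in\operatorname{ri}\mathcal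 X_i$. (If $\operatorname{dom}J_i=\mathcal X_i\times\mathbb R^l$ for all $i$, or all $J_i$ are finite everywhere, this just says that some $x\in\prod_i\mathcal X_i$ has $\sum_iA_ix_i<c$.) 3. (P) has a minimizer (a feasible point with $J<+\infty$ and minimal value). 4. $\mathcal G=(\mathcal N,\mathcal E)$ is a graph with directed edges (tail, head) that is undirected ($(i,j)\in\mathcal E\Leftrightarrow(j,i)\in\mathcal E$), connected and without self-loops, and every agent has an out-neighbour. $\mathcal N_i^+$ and $\mathcal N_i^-$ denote the in- and out-neighbours of $i$. $W\in\mathbb R^{N\times N}$ has $W_{ij}<0$ for $(i,j)\in\mathcal E$, $W_{ij}=0$ for all other $i\neq j$, and $W_{ii}=-\sum_{j\ne i}W_{ij}$. *The operator $T$.* Let $\psi=[x;\sigma;\lambda;\omega]$ with $\sigma_i\in\mathbb R^l$ per agent, $\lambda_{ji}\in\mathbb R^l$ per edge $(j,i)$, and $\omega=[\omega_i]_i$ where $\omega_i$ collects $y_i\in\mathbb R^l$ and $\mu_{ij},y_{ij}\in\mathbb R^l$ for $j\in\mathcal N_i^-$; put $\boldsymbol y_i=[y_i;[y_{ji}]_{j\in\mathcal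 N_i^+}]$. Let $\mathcal Q_i=\{(x_i,\sigma_i):A_ix_i+\sigma_i\le c\}$ and $\mathcal F_i=\{(x_i,\sigma_i,\boldsymbol y_i):(N-1)A_ix_i-\sigma_i=W_{ii}y_i+\sum_{j\in\mathcal N_i^+}W_{ji}y_{ji}\}$. Let $A=\operatorname{blkd}(A_i)$ and $B_l=B\otimes I_l$ with $B$ the incidence matrix ($+1$ at the head, $-1$ at the tail of an edge), and let $M_y'$ be the skew-symmetric linear map sending $\omega$ to the vector with $y_i$-component $-\sum_{j\in\mathcal N_i^-}\mu_{ij}$, $\mu_{ij}$-component $y_i-y_{ij}$ and $y_{ij}$-component $\mu_{ij}$. With $\iota$ the indicator function ($0$ on the set, $+\infty$ off it), define $$T\psi=\partial\Big(\sum_iJ_i(x_i,\sigma_i)+\iota_{\mathcal X_i}(x_i)+\iota_{\mathcal Q_i}(x_i,\sigma_i)+\iota_{\mathcal F_i}(x_i,\sigma_i,\boldsymbol y_i)\Big)+\begin{bmatrix}0&0&A^TB_l&0\\0&0&B_l&0\\-B_l^TA&-B_l^T&0&0\\0&0&0&M_y'\end{bmatrix}\psi .$$ Let $\tau_{1i},\tau_{2i},\tau_{4i}>0$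 ($i\in\mathcal N$) and $\tau_{3e}>0$ ($e\in\mathcal E$) be step sizes, let $\boldsymbol\tau_1,\dots,\boldsymbol\tau_4$ be the corresponding diagonal matrices (in $\boldsymbol\tau_4$ every component of $\omega_i$ has the entry $\tau_{4i}$), and $$\Phi=\begin{bmatrix}\boldsymbol\tau_1^{-1}&0&-\frac12A^TB_l&0\\0&\boldsymbol\tau_2^{-1}&-\frac12B_l&0\\-\frac12B_l^TA&-\frac12B_l^T&\boldsymbol\tau_3^{-1}&0\\0&0&0&\boldsymbol\tau_4^{-1}\end{bmatrix}.$$ *The algorithm.* Put $\lambda_{iB}=\sum_{j\in\mathcal N_i^+}\lambda_{ji}-\sum_{j\in\mathcal N_i^-}\lambda_{ij}$ and, for an edge $(j,i)$, $\delta_{ji}(\psi)=A_ix_i+\sigma_i-A_jx_j-\sigma_j$. From an arbitrary $\tilde\psi^{(0)}$, iteration $k=0,1,\dots$ computes $\psi=\psi^{(k+1)}$, $\hat\psi=\hat\psi^{(k+1)}$, $\bar\psi=\bar\psi^{(k+1)}$ and $\tilde\psi^{(k+1)}$ from $\tilde\psi=\tilde\psi^{(k)}$ as follows. - $y_i=\frac{1+\tau_{4i}^2}{1+\tau_{4i}^2(1+|\mathcal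 N_i^-|)}\Big(\tilde y_i+\frac{\tau_{4i}}{1+\tau_{4i}^2}\sum_{j\in\mathcal N_i^-}(\tilde\mu_{ij}+\tau_{4i}\tilde y_{ij})\Big)$ for $i\in\mathcal N$; then $\mu_{ji}=\frac{1}{1+\tau_{4j}^2}\tilde\mu_{ji}+\frac{\tau_{4j}}{1+\tau_{4j}^2}(\tilde y_{ji}-y_j)$ and $y_{ji}=\tilde y_{ji}-\tau_{4j}\mu_{ji}$ for $(j,i)\in\mathcal E$. - $(x_i,\sigma_i)$ minimizes $J_i(x_i,\sigma_i)+\frac12\tilde\lambda_{iB}^T(A_ix_i+\sigma_i)+\frac1{2\tau_{1i}}\|x_i-\tilde x_i\|^2+\frac1{2\tau_{2i}}\|\sigma_i-\tilde\sigma_i\|^2$. - $\lambda_{ji}=\tilde\lambda_{ji}+\frac12\tau_{3ji}\,\delta_{ji}(\hat\psi)$, where $\hat\psi=2\psi-\tilde\psi$ (only its $x$- and $\sigma$-components are needed here). - $(\bar x_i,\bar\sigma_i,\bar{\boldsymbol y}_i)$ minimizes $\frac1{2\tau_{1i}}\|x_i-\hat x_i+\frac{\tau_{1i}}2A_i^T\hat\lambda_{iB}\|^2+\frac1{2\tau_{2i}}\|\sigma_i-\hat\sigma_i+\frac{\tau_{2i}}2\hat\lambda_{iB}\|^2+\frac1{2\tau_{4i}}\|y_i-\hat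 y_i\|^2+\sum_{j\in\mathcal N_i^+}\frac1{2\tau_{4j}}\|y_{ji}-\hat y_{ji}\|^2$ subject to $x_i\in\mathcal X_i$, $(x_i,\sigma_i,\boldsymbol y_i)\in\mathcal F_i$, $A_ix_i+\sigma_i\le c$. - $\bar\lambda_{ji}=\hat\lambda_{ji}+\tau_{3ji}\big(\delta_{ji}(\bar\psi)-\frac12\delta_{ji}(\hat\psi)\big)$ and $\bar\mu_{ji}=\hat\mu_{ji}$. - $\tilde\psi^{(k+1)}=\tilde\psi^{(k)}+2\gamma^{(k)}(\bar\psi-\psi)$. *Claim.* Suppose assumptions 1–4 hold, $\Phi$ is positive definite, $\gamma^{(k)}\in[0,1]$ for all $k$, and $\sum_k\gamma^{(k)}(1-\gamma^{(k)})=+\infty$. Then, from every initial point, the algorithm can be carried out, and every sequence $(\psi^{(k)})_{k\ge1}$ that it generates converges to some $\psi^*=[x^*;\sigma^*;\lambda^*;\omega^*]$ with $0\in T\psi^*$; in particular $x^{(k)}\to x^*$, and $x^*$ is a minimizer of (P). -/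

import Mathlib

open Filter Topology
open scoped Matrix Kronecker

noncomputable section

/-! ### Convex analysis on real coordinate spaces -/

/-- Effective domain of an extended-real-valued function. -/
def effDom {α : Type*} (f : α → EReal) : Set α := {z | f z < ⊤}

/-- Indicator function of a set in the sense of convex analysis. -/
def iota {α : Type*} (S : Set α) (z : α) : EReal :=
  open Classical in if z ∈ S then 0 else ⊤

/-- Closed convex proper functions with values in `ℝ ∪ {+∞}`: the epigraph is closed and convex,
the value `-∞` is never taken, and the function is not identically `+∞`. -/
structure IsCCP {α : Type*} [AddCommGroup α] [Module ℝ α] [TopologicalSpace α]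
    (f : α → EReal) : Prop where
  convex_epi : Convex ℝ {p : α × ℝ | f p.1 ≤ (p.2 : EReal)}
  closed_epi : IsClosed {p : α × ℝ | f p.1 ≤ (p.2 : EReal)}
  ne_bot : ∀ z, f z ≠ ⊥
  proper : ∃ z, f z ≠ ⊤

/-- Subdifferential of a function on the Euclidean space `ℝ^ι`. -/
def subdiff {ι : Type*} [Fintype ι] (f : (ι → ℝ) → EReal) (z : ι → ℝ) : Set (ι → ℝ) :=
  {g | ∀ w, f z + ((g ⬝ᵥ (w - z) : ℝ) : EReal) ≤ f w}

/-- Zero set of a set-valued operator. -/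
def zer {ι : Type*} (T : (ι → ℝ) → Set (ι → ℝ)) : Set (ι → ℝ) := {z | (0 : ι → ℝ) ∈ T z}

/-- Squared Euclidean norm. -/
def sqNorm {ι : Type*} [Fintype ι] (v : ι → ℝ) : ℝ := v ⬝ᵥ v

/-! ### The multi-agent problem and its communication network -/

/-- The data: agents `Fin N`, decisions `x_i ∈ ℝ^(n i)`, `l` shared resources, coupling matrices
`A i`, availability `c`, local feasible sets `X i`, objectives `J i (x_i, s_i)`, directed edges
`(tail, head)` of the communication graph, and the weight matrix `W`. -/
structure Network (N l : ℕ) (n : Fin N → ℕ) where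
  A : (i : Fin N) → Matrix (Fin l) (Fin (n i)) ℝ
  c : Fin l → ℝ
  X : (i : Fin N) → Set (Fin (n i) → ℝ)
  J : (i : Fin N) → (Fin (n i) → ℝ) × (Fin l → ℝ) → EReal
  E : Finset (Fin N × Fin N)
  W : Matrix (Fin N) (Fin N) ℝ

namespace Network

variable {N l : ℕ} {n : Fin N → ℕ} (P : Network N l n)

/-- The aggregate `s_i(x_{-i}) = ∑_{j ≠ i} A_j x_j`. -/
def aggregate (x : (i : Fin N) → Fin (n i) → ℝ) (i : Fin N) : Fin l → ℝ :=
  ∑ j ∈ Finset.univ.erase i, P.A j *ᵥ x j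

/-- The global objective `J(x) = ∑ i, J_i(x_i, s_i(x_{-i}))`. -/
def totalCost (x : (i : Fin N) → Fin (n i) → ℝ) : EReal :=
  ∑ i, P.J i (x i, P.aggregate x i)

/-- The global feasible set: `x_i ∈ X_i` for all `i` and `∑ i, A_i x_i ≤ c`. -/
def feasible : Set ((i : Fin N) → Fin (n i) → ℝ) :=
  {x | (∀ i, x i ∈ P.X i) ∧ ∑ i, P.A i *ᵥ x i ≤ P.c}

/-- Minimizers of the global problem. -/
def minimizers : Set ((i : Fin N) → Fin (n i) → ℝ) :=
  {x | x ∈ P.feasible ∧ P.totalCost x < ⊤ ∧ ∀ x' ∈ P.feasible, P.totalCost x ≤ P.totalCost x'}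

/-- A Slater point of the problem with extended-real-valued objectives: the coupling inequality is
strict and the point is relatively interior to the domains of the objectives and to the local
feasible sets. Objectives that are only defined on `X_i × ℝ^l` are extended by `+∞`; then
`dom J_i ⊆ X_i × ℝ^l`, and the domain of `J_i` already accounts for the set `X_i`.
If `dom J_i = X_i × ℝ^l` for every `i`, or if every `J_i` is finite everywhere, a Slater point
exists if and only if some `x` with `x_i ∈ X_i` has `∑ i, A_i x_i < c` in every coordinate. -/
structure IsSlaterPoint (x : (i : Fin N) → Fin (n i) → ℝ) : Prop where
  mem : ∀ i, x i ∈ P.X i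
  strict : ∀ a, (∑ i, P.A i *ᵥ x i) a < P.c a
  mem_ri_dom : ∀ i, (x i, P.aggregate x i) ∈ intrinsicInterior ℝ (effDom (P.J i))
  mem_ri_set : ∀ i, effDom (P.J i) ⊆ P.X i ×ˢ Set.univ ∨ x i ∈ intrinsicInterior ℝ (P.X i)

/-- Assumption on the feasible sets: nonempty, closed, convex, with Slater's condition. -/
structure FeasibleSetsRegular : Prop where
  nonempty : ∀ i, (P.X i).Nonempty
  closed : ∀ i, IsClosed (P.X i)
  convex : ∀ i, Convex ℝ (P.X i)
  slater : ∃ x, P.IsSlaterPoint x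

/-- Assumption on the communication graph: undirected (the set of directed edges is symmetric),
connected, without self-loops, and every agent has an out-neighbour. -/
structure Communicable : Prop where
  symm : ∀ i j, (i, j) ∈ P.E → (j, i) ∈ P.E
  connected : (SimpleGraph.fromRel fun i j => (i, j) ∈ P.E).Connected
  no_loops : ∀ i, (i, i) ∉ P.E
  out_nonempty : ∀ i, ∃ j, (i, j) ∈ P.E

/-- `W` is a weight matrix of the communication graph; it need not be symmetric. -/
structure IsWeighted : Prop where
  neg : ∀ i j, (i, j) ∈ P.E → P.W i j < 0
  zero : ∀ i j, i ≠ j → (i, j) ∉ P.E → P.W i j = 0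
  diag : ∀ i, P.W i i = -∑ j ∈ Finset.univ.erase i, P.W i j

/-! ### The stacked variable `ψ = [x; σ; λ; ω]` -/

/-- Directed edges `(tail, head)`. -/
abbrev Edge : Type := {e : Fin N × Fin N // e ∈ P.E}

/-- In-edges of agent `i`, that is, the edges `(j, i)` with `j` an in-neighbour of `i`. -/
abbrev InEdge (i : Fin N) : Type := {e : P.Edge // e.1.2 = i}

/-- Scalar components of `ω`: the `y_i` (agents), the `μ_{ij}` (edges), the `y_{ij}` (edges). -/
abbrev OmegaIdx : Type := Fin N ⊕ (P.Edge ⊕ P.Edge)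

/-- The agent `i` whose block `ω_i` contains a component: `y_i`, `μ_{ij}` and `y_{ij}` all belong
to `ω_i`. -/
def omegaOwner : P.OmegaIdx → Fin N
  | .inl i => i
  | .inr (.inl e) => e.1.1
  | .inr (.inr e) => e.1.1

/-- Coordinates of `ψ = [x; σ; λ; ω]`, grouped as `([x; σ]; [λ; ω])`. -/
abbrev Idx : Type :=
  ((Σ i : Fin N, Fin (n i)) ⊕ (Fin N × Fin l)) ⊕ ((P.Edge × Fin l) ⊕ (P.OmegaIdx × Fin l))

abbrev State : Type := P.Idx → ℝ

variable {P}

def xPart (ψ : P.State) (i : Fin N) : Fin (n i) → ℝ := fun a => ψ (.inl (.inl ⟨i, a⟩))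

def sigPart (ψ : P.State) (i : Fin N) : Fin l → ℝ := fun a => ψ (.inl (.inr (i, a)))

/-- `lamPart ψ e` is `λ_{ji}` for the edge `e = (j, i)`. -/
def lamPart (ψ : P.State) (e : P.Edge) : Fin l → ℝ := fun a => ψ (.inr (.inl (e, a)))

def yPart (ψ : P.State) (i : Fin N) : Fin l → ℝ := fun a => ψ (.inr (.inr (.inl i, a)))

/-- `muPart ψ e` is `μ_{ji}` for the edge `e = (j, i)`. -/
def muPart (ψ : P.State) (e : P.Edge) : Fin l → ℝ := fun a => ψ (.inr (.inr (.inr (.inl e), a)))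

/-- `yEdgePart ψ e` is `y_{ji}`, the estimate of `y_j` kept by agent `i`, for the edge
`e = (j, i)`. -/
def yEdgePart (ψ : P.State) (e : P.Edge) : Fin l → ℝ :=
  fun a => ψ (.inr (.inr (.inr (.inr e), a)))

/-- `λ_{iB} = ∑_{j ∈ N_i^+} λ_{ji} - ∑_{j ∈ N_i^-} λ_{ij}`. -/
def lamB (ψ : P.State) (i : Fin N) : Fin l → ℝ :=
  (∑ e : P.Edge, if e.1.2 = i then lamPart ψ e else 0) -
    ∑ e : P.Edge, if e.1.1 = i then lamPart ψ e else 0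

/-- `A_i x_i + σ_i - A_j x_j - σ_j` for the edge `e = (j, i)`. -/
def disagreement (ψ : P.State) (e : P.Edge) : Fin l → ℝ :=
  P.A e.1.2 *ᵥ xPart ψ e.1.2 + sigPart ψ e.1.2 - P.A e.1.1 *ᵥ xPart ψ e.1.1 - sigPart ψ e.1.1

variable (P)

/-! ### The operator `T` and the design matrix -/

/-- The block diagonal matrix of the `A_i`. -/
def bigA : Matrix (Fin N × Fin l) (Σ i : Fin N, Fin (n i)) ℝ :=
  Matrix.of fun p q => if p.1 = q.1 then P.A q.1 p.2 q.2 else 0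

/-- Incidence matrix: the column of an edge is `+1` at its head and `-1` at its tail. -/
def incidence : Matrix (Fin N) P.Edge ℝ :=
  Matrix.of fun i e => (if e.1.2 = i then 1 else 0) - (if e.1.1 = i then 1 else 0)

/-- `B_l = B ⊗ I_l`. -/
def Bl : Matrix (Fin N × Fin l) (P.Edge × Fin l) ℝ :=
  P.incidence ⊗ₖ (1 : Matrix (Fin l) (Fin l) ℝ)

/-- The skew-symmetric matrix `M_y'` (before the Kronecker product with `I_l`): row `y_i` is
`-∑_j μ_{ij}`, row `μ_{ij}` is `y_i - y_{ij}`, row `y_{ij}` is `μ_{ij}`. -/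
def My : Matrix P.OmegaIdx P.OmegaIdx ℝ :=
  Matrix.of fun r s =>
    match r, s with
    | .inl i, .inr (.inl e) => if e.1.1 = i then -1 else 0
    | .inr (.inl e), .inl i => if e.1.1 = i then 1 else 0
    | .inr (.inl e), .inr (.inr e') => if e = e' then -1 else 0
    | .inr (.inr e), .inr (.inl e') => if e = e' then 1 else 0
    | _, _ => 0

/-- The linear part of `T`. -/
def linT : Matrix P.Idx P.Idx ℝ :=
  Matrix.fromBlocks
    0 (Matrix.fromBlocks (P.bigAᵀ * P.Bl) 0 P.Bl 0)
    (Matrix.fromBlocks (-(P.Blᵀ * P.bigA)) (-P.Blᵀ) 0 0)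
    (Matrix.fromBlocks 0 0 0 (P.My ⊗ₖ (1 : Matrix (Fin l) (Fin l) ℝ)))

/-- `Q_i = {(x_i, σ_i) | A_i x_i + σ_i ≤ c}`. -/
def setQ (i : Fin N) : Set ((Fin (n i) → ℝ) × (Fin l → ℝ)) :=
  {z | P.A i *ᵥ z.1 + z.2 ≤ P.c}

/-- The variables `(x_i, σ_i, y_i, [y_{ji}]_{j ∈ N_i^+})` kept by agent `i`. -/
abbrev Local (i : Fin N) : Type :=
  (Fin (n i) → ℝ) × (Fin l → ℝ) × (Fin l → ℝ) × (P.InEdge i → Fin l → ℝ)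

/-- `F_i`: the relation `(N-1) A_i x_i - σ_i = W_ii y_i + ∑_{j ∈ N_i^+} W_ji y_{ji}`. -/
def setF (i : Fin N) : Set (P.Local i) :=
  {z | ((N : ℝ) - 1) • (P.A i *ᵥ z.1) - z.2.1 =
    P.W i i • z.2.2.1 + ∑ e : P.InEdge i, P.W e.1.1.1 i • z.2.2.2 e}

variable {P} in
/-- The variables of agent `i` within `ψ`. -/
def localPart (ψ : P.State) (i : Fin N) : P.Local i :=
  (xPart ψ i, sigPart ψ i, yPart ψ i, fun e => yEdgePart ψ e.1)

/-- `∑ i, (J_i(x_i, σ_i) + ι_{X_i}(x_i) + ι_{Q_i}(x_i, σ_i) + ι_{F_i}(x_i, σ_i, y_i))`. -/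
def convexPart (ψ : P.State) : EReal :=
  ∑ i, (P.J i (xPart ψ i, sigPart ψ i) + iota (P.X i) (xPart ψ i) +
    iota (P.setQ i) (xPart ψ i, sigPart ψ i) + iota (P.setF i) (localPart ψ i))

/-- The set-valued operator `T`. -/
def opT (ψ : P.State) : Set P.State :=
  {u | ∃ g ∈ subdiff P.convexPart ψ, u = g + P.linT *ᵥ ψ}

/-- Positive step sizes: `τ₁, τ₂, τ₄` per agent and `τ₃` per edge. -/
structure StepSizes where
  t1 : Fin N → ℝ
  t2 : Fin N → ℝ
  t3 : P.Edge → ℝ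
  t4 : Fin N → ℝ
  t1_pos : ∀ i, 0 < t1 i
  t2_pos : ∀ i, 0 < t2 i
  t3_pos : ∀ e, 0 < t3 e
  t4_pos : ∀ i, 0 < t4 i

variable {P}

/-- The design matrix `Φ`. -/
def designMatrix (τ : P.StepSizes) : Matrix P.Idx P.Idx ℝ :=
  Matrix.fromBlocks
    (Matrix.fromBlocks (Matrix.diagonal fun q => (τ.t1 q.1)⁻¹) 0
      0 (Matrix.diagonal fun q => (τ.t2 q.1)⁻¹))
    (Matrix.fromBlocks (-((1 / 2 : ℝ) • (P.bigAᵀ * P.Bl))) 0 (-((1 / 2 : ℝ) • P.Bl)) 0)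
    (Matrix.fromBlocks (-((1 / 2 : ℝ) • (P.Blᵀ * P.bigA))) (-((1 / 2 : ℝ) • P.Blᵀ)) 0 0)
    (Matrix.fromBlocks (Matrix.diagonal fun q => (τ.t3 q.1)⁻¹) 0
      0 (Matrix.diagonal fun q => (τ.t4 (P.omegaOwner q.1))⁻¹))

/-! ### The algorithm -/

/-- The subroutine that computes `y_i`, `μ_{ji}`, `y_{ji}` of the state `ψ` from those of `ψt`. -/
structure AuxConsensusUpdate (τ : P.StepSizes) (ψt ψ : P.State) : Prop where
  y : ∀ i, yPart ψ i =
    ((1 + τ.t4 i ^ 2) /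
        (1 + τ.t4 i ^ 2 * (1 + ((Finset.univ.filter fun e : P.Edge => e.1.1 = i).card : ℝ)))) •
      (yPart ψt i + (τ.t4 i / (1 + τ.t4 i ^ 2)) •
        ∑ e : P.Edge, if e.1.1 = i then muPart ψt e + τ.t4 i • yEdgePart ψt e else 0)
  mu : ∀ e : P.Edge, muPart ψ e =
    (1 / (1 + τ.t4 e.1.1 ^ 2)) • muPart ψt e +
      (τ.t4 e.1.1 / (1 + τ.t4 e.1.1 ^ 2)) • (yEdgePart ψt e - yPart ψ e.1.1)
  yEdge : ∀ e : P.Edge, yEdgePart ψ e = yEdgePart ψt e - τ.t4 e.1.1 • muPart ψ e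

/-- The objective of the first local problem of agent `i`. -/
def localObjA (τ : P.StepSizes) (ψt : P.State) (i : Fin N)
    (z : (Fin (n i) → ℝ) × (Fin l → ℝ)) : EReal :=
  P.J i z + (((1 / 2) * (lamB ψt i ⬝ᵥ (P.A i *ᵥ z.1 + z.2)) +
    1 / (2 * τ.t1 i) * sqNorm (z.1 - xPart ψt i) +
    1 / (2 * τ.t2 i) * sqNorm (z.2 - sigPart ψt i) : ℝ) : EReal)

/-- The objective of the second local problem of agent `i`. The estimate `y_{ji}` is a component
of `ω_j`, so its step size in the design matrix is `τ_{4j}`. -/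
def localObjB (τ : P.StepSizes) (ψh : P.State) (i : Fin N) (z : P.Local i) : ℝ :=
  1 / (2 * τ.t1 i) * sqNorm (z.1 - (xPart ψh i - (τ.t1 i / 2) • ((P.A i)ᵀ *ᵥ lamB ψh i))) +
  1 / (2 * τ.t2 i) * sqNorm (z.2.1 - (sigPart ψh i - (τ.t2 i / 2) • lamB ψh i)) +
  1 / (2 * τ.t4 i) * sqNorm (z.2.2.1 - yPart ψh i) +
  ∑ e : P.InEdge i, 1 / (2 * τ.t4 e.1.1.1) * sqNorm (z.2.2.2 e - yEdgePart ψh e.1)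

variable (P) in
/-- The feasible set of the second local problem of agent `i`. -/
def localFeasB (i : Fin N) : Set (P.Local i) :=
  {z | z.1 ∈ P.X i ∧ z ∈ P.setF i ∧ P.A i *ᵥ z.1 + z.2.1 ≤ P.c}

/-- One iteration with relaxation parameter `γ`: from `ψt` (tilde), the state `ψ`, the reflected
state `ψh` (hat), the state `ψb` (bar), and the next `ψt'` (tilde). -/
structure Iteration (τ : P.StepSizes) (γ : ℝ) (ψt ψ ψh ψb ψt' : P.State) : Prop where
  acu : AuxConsensusUpdate τ ψt ψ
  argminA : ∀ i, IsMinOn (localObjA τ ψt i) Set.univ (xPart ψ i, sigPart ψ i)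
  reflect : ψh = (2 : ℝ) • ψ - ψt
  lam : ∀ e : P.Edge, lamPart ψ e = lamPart ψt e + ((1 / 2) * τ.t3 e) • disagreement ψh e
  feasB : ∀ i, localPart ψb i ∈ P.localFeasB i
  argminB : ∀ i, IsMinOn (localObjB τ ψh i) (P.localFeasB i) (localPart ψb i)
  lamBar : ∀ e : P.Edge, lamPart ψb e =
    lamPart ψh e + τ.t3 e • (disagreement ψb e - (1 / 2 : ℝ) • disagreement ψh e)
  muBar : ∀ e : P.Edge, muPart ψb e = muPart ψh e
  relax : ψt' = ψt + (2 * γ) • (ψb - ψ)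

/-- `ψ` is a sequence generated by the algorithm with step sizes `τ`, relaxation parameters `γ` and
initial state `ψ0`. The entry `ψ 0` is not produced by the algorithm and is arbitrary. -/
def IsGenerated (τ : P.StepSizes) (γ : ℕ → ℝ) (ψ0 : P.State) (ψ : ℕ → P.State) : Prop :=
  ∃ ψt ψh ψb : ℕ → P.State, ψt 0 = ψ0 ∧
    ∀ k, Iteration τ (γ k) (ψt k) (ψ (k + 1)) (ψh (k + 1)) (ψb (k + 1)) (ψt (k + 1))

end Network

end

/-!
The algorithm is a relaxed Peaceman-Rachford splitting of `T` in the inner product defined by `Φ`.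
Split `T = A + B` so that each summand contains one half of the coupling between `(x, σ)` and `λ`:
`A` is the subdifferential of `∑ J_i` plus the skew-symmetric consensus terms in `ω`, and `B` is the
normal cone of the local constraints. Both operators are monotone. The halved coupling cancels the
off-diagonal blocks of `Φ` in the direction from `λ` to `(x, σ)`, so that the inclusions
`Φ (ψt - ψ) ∈ A ψ` and `Φ (ψh - ψb) ∈ B ψb` decouple into the local steps of an iteration. In the
metric of `Φ` the product of the two reflected resolvents is nonexpansive, and the
Krasnoselskii-Mann iteration of a nonexpansive map with a fixed point converges.

A fixed point exists because a minimizer of (P) satisfies the optimality conditions `0 ∈ T ψ`: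
its `σ`-component is the aggregate, `y` is a potential for the weighted Laplacian `W`, and the
dual components come from a Fenchel-Rockafellar argument that only needs the relative interiors of
Slater's condition. Conversely a zero of `T` is in consensus, and pairing its inclusion with
differences of consensus states, on which the skew-symmetric part vanishes, gives optimality.
-/

noncomputable section

/-! ### Separation in real vector spaces -/

section Separation

variable {E F : Type*} [AddCommGroup E] [Module ℝ E] [AddCommGroup F] [Module ℝ F]

theorem exists_linearMap_le_of_absorbing {C : Set (E × ℝ)} (hC : Convex ℝ C) (h0 : (0, 0) ∈ C)
    {D : Submodule ℝ E} (hmin : ∀ w t, (w, t) ∈ C → w ∈ D → 0 ≤ t)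
    (habs : ∀ u : E, ∃ ε : ℝ, 0 < ε ∧ ∃ d ∈ D, ∃ t, (d + ε • u, t) ∈ C) :
    ∃ φ : E →ₗ[ℝ] ℝ, (∀ d ∈ D, φ d = 0) ∧ ∀ w t, (w, t) ∈ C → φ w ≤ t := by
  -- The required functional is the graph part of a positive extension of `(d, t) ↦ t`.
  let K : PointedCone ℝ (E × ℝ) := (ConvexCone.hull ℝ C).toPointedCone (ConvexCone.subset_hull h0)
  let f : (E × ℝ) →ₗ.[ℝ] ℝ := ⟨D.prod ⊤, (LinearMap.snd ℝ E ℝ).comp (D.prod ⊤).subtype⟩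
  have hf_nonneg : ∀ p : f.domain, (p : E × ℝ) ∈ K → 0 ≤ f p := by
    rintro ⟨p, hp⟩ hpK
    obtain ⟨r, hr, ⟨w, t⟩, hwt, rfl⟩ := (ConvexCone.mem_hull_of_convex hC).1 hpK
    exact mul_nonneg hr.le (hmin w t hwt ((D.smul_mem_iff hr.ne').1 hp.1))
  have hf_dense : ∀ p, ∃ q : f.domain, (q : E × ℝ) + p ∈ K := by
    rintro ⟨u, s⟩
    obtain ⟨ε, hε, d, hd, t, ht⟩ := habs u
    refine ⟨⟨(ε⁻¹ • d, ε⁻¹ * t - s), D.smul_mem _ hd, trivial⟩,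
      (ConvexCone.mem_hull_of_convex hC).2 ⟨ε⁻¹, inv_pos.2 hε, _, ht, ?_⟩⟩
    simp [smul_smul, hε.ne']
  obtain ⟨g, hgf, hgK⟩ := riesz_extension K f hf_nonneg hf_dense
  have hg_split : ∀ w t, g (w, t) = g (w, 0) + t := fun w t => by
    have h : g (0, t) = t := hgf ⟨(0, t), D.zero_mem, trivial⟩
    nth_rewrite 2 [← h]
    rw [← map_add, Prod.mk_add_mk, add_zero, zero_add]
  refine ⟨-(g.comp (LinearMap.inl ℝ E ℝ)), fun d hd => ?_, fun w t hwt => ?_⟩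
  · exact neg_eq_zero.2 (hgf ⟨(d, 0), hd, trivial⟩)
  · have := hgK (w, t) (ConvexCone.subset_hull hwt)
    rw [hg_split] at this
    exact neg_le_iff_add_nonneg'.2 this

/-- The relative core of a set, the algebraic counterpart of the relative interior: every segment in
`S` that ends at the point can be prolonged beyond it within `S`. All short prolongations are
required, which makes the notion stable under intersections also for nonconvex sets. -/
def relCore (S : Set E) : Set E :=
  {z | z ∈ S ∧ ∀ w ∈ S, ∀ᶠ ε in 𝓝[>] (0 : ℝ), z - ε • (w - z) ∈ S}

theorem mem_relCore_inter {S T : Set E} {z : E} (hS : z ∈ relCore S) (hT : z ∈ relCore T) :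
    z ∈ relCore (S ∩ T) :=
  ⟨⟨hS.1, hT.1⟩, fun w hw => (hS.2 w hw.1).and (hT.2 w hw.2)⟩

theorem mem_relCore_iInter {ι : Type*} [Finite ι] {S : ι → Set E} {z : E}
    (h : ∀ i, z ∈ relCore (S i)) : z ∈ relCore (⋂ i, S i) := by
  refine ⟨Set.mem_iInter.2 fun i => (h i).1, fun w hw => ?_⟩
  simp only [Set.mem_iInter] at hw ⊢
  exact eventually_all.2 fun i => (h i).2 w (hw i)

theorem mem_relCore_preimage {S : Set F} {z : E} (L : E →ₗ[ℝ] F) (h : L z ∈ relCore S) :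
    z ∈ relCore (L ⁻¹' S) :=
  ⟨h.1, fun w hw => (h.2 (L w) hw).mono fun ε hε => by
    simpa only [Set.mem_preimage, map_sub, map_smul] using hε⟩

theorem tendsto_const_mul_nhdsGT_zero {c : ℝ} (hc : 0 < c) :
    Tendsto (fun ε => c * ε) (𝓝[>] 0) (𝓝[>] 0) := by
  refine tendsto_nhdsWithin_iff.2 ⟨Tendsto.mono_left ?_ nhdsWithin_le_nhds, ?_⟩
  · exact (continuous_const_mul c).tendsto' 0 0 (mul_zero c)
  · filter_upwards [self_mem_nhdsWithin] with ε hε using mul_pos hc hε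

theorem eventually_add_smul_mem_of_mem_span {S : Set E} (hS : Convex ℝ S) {z : E}
    (hz : z ∈ relCore S) {u : E} (hu : u ∈ Submodule.span ℝ ((fun w => w - z) '' S)) :
    ∀ᶠ ε in 𝓝[>] (0 : ℝ), z + ε • u ∈ S := by
  induction hu using Submodule.span_induction with
  | mem x hx =>
    obtain ⟨w, hw, rfl⟩ := hx
    filter_upwards [Ioc_mem_nhdsGT one_pos] with ε hε
    exact hS.add_smul_sub_mem hz.1 hw ⟨hε.1.le, hε.2⟩
  | zero => exact .of_forall fun ε => by simpa using hz.1
  | add x y _ _ hx hy =>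
    have h2 := tendsto_const_mul_nhdsGT_zero two_pos
    filter_upwards [h2.eventually hx, h2.eventually hy] with ε hx hy
    convert hS hx hy (a := 1 / 2) (b := 1 / 2) (by norm_num) (by norm_num) (by norm_num) using 1
    module
  | smul a x _ hx =>
    rcases lt_trichotomy a 0 with ha | rfl | ha
    · obtain ⟨δ, hxδ, hδ⟩ := (hx.and self_mem_nhdsWithin).exists
      replace hδ : 0 < δ := hδ
      filter_upwards [(tendsto_const_mul_nhdsGT_zero (div_pos (neg_pos.2 ha) hδ)).eventually
        (hz.2 _ hxδ)] with ε hε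
      convert hε using 1
      rw [add_sub_cancel_left, smul_smul, smul_smul, sub_eq_add_neg, ← neg_smul]
      congr 2
      field_simp
    · exact .of_forall fun ε => by simpa using hz.1
    · filter_upwards [(tendsto_const_mul_nhdsGT_zero ha).eventually hx] with ε hε
      rwa [smul_smul, mul_comm]

theorem exists_linearMap_le_of_mem_relCore {C : Set (E × ℝ)} (hC : Convex ℝ C)
    {D : Submodule ℝ E} {z : E} {a : ℝ} (hz : (z, a) ∈ C)
    (hmin : ∀ w t, (w, t) ∈ C → w - z ∈ D → a ≤ t)
    {b : E} (hb : b - z ∈ D) (hbC : b ∈ relCore (Prod.fst '' C)) :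
    ∃ φ : E →ₗ[ℝ] ℝ, (∀ d ∈ D, φ d = 0) ∧ ∀ w t, (w, t) ∈ C → φ (w - z) ≤ t - a := by
  -- Inside the span `V` of all relevant directions the translated set is absorbing modulo `D`.
  let U : Submodule ℝ E := Submodule.span ℝ ((fun w => w - b) '' (Prod.fst '' C))
  let V : Submodule ℝ E := U ⊔ D
  have hzV : ∀ w t, (w, t) ∈ C → w - z ∈ V := fun w t hwt => by
    have hwb : w - b ∈ U := Submodule.subset_span ⟨w, ⟨_, hwt, rfl⟩, rfl⟩
    simpa using V.add_mem (Submodule.mem_sup_left hwb) (Submodule.mem_sup_right hb)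
  let C' : Set (V × ℝ) := {p | (z + (p.1 : E), a + p.2) ∈ C}
  have hC' : Convex ℝ C' :=
    (hC.translate_preimage_right (z, a)).linear_preimage (V.subtype.prodMap LinearMap.id)
  have habs : ∀ u : V, ∃ ε : ℝ, 0 < ε ∧ ∃ d ∈ D.comap V.subtype, ∃ t, (d + ε • u, t) ∈ C' := by
    rintro ⟨u, hu⟩
    obtain ⟨u₁, hu₁, d, hd, rfl⟩ := Submodule.mem_sup.1 hu
    have hfst : Convex ℝ (Prod.fst '' C) := hC.linear_image (LinearMap.fst ℝ E ℝ)
    obtain ⟨ε, ⟨⟨w, t⟩, ht, hw⟩, hε⟩ :=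
      ((eventually_add_smul_mem_of_mem_span hfst hbC hu₁).and self_mem_nhdsWithin).exists
    have hdD : b - z - ε • d ∈ D := D.sub_mem hb (D.smul_mem _ hd)
    refine ⟨ε, hε, ⟨_, Submodule.mem_sup_right hdD⟩, hdD, t - a, ?_⟩
    change (z + (b - z - ε • d + ε • (u₁ + d)), a + (t - a)) ∈ C
    convert ht using 2
    · rw [show w = b + ε • u₁ from hw]
      module
    · ring
  obtain ⟨φ, hφD, hφ⟩ := exists_linearMap_le_of_absorbing hC' (by simpa [C'] using hz)
    (fun w t hwt hw => by linarith [hmin _ _ hwt (by simpa using hw)]) habs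
  obtain ⟨φ', rfl⟩ := φ.exists_extend
  exact ⟨φ', fun d hd => hφD ⟨d, Submodule.mem_sup_right hd⟩ hd,
    fun w t hwt => hφ ⟨w - z, hzV w t hwt⟩ _ (by simpa [C'] using hwt)⟩

end Separation

theorem intrinsicInterior_subset_relCore {E : Type*} [NormedAddCommGroup E] [NormedSpace ℝ E]
    (S : Set E) : intrinsicInterior ℝ S ⊆ relCore S := by
  intro z hz
  refine ⟨intrinsicInterior_subset hz, fun w hw => ?_⟩
  obtain ⟨y, hy, rfl⟩ := mem_intrinsicInterior.1 hz
  have hmem : ∀ ε : ℝ, (y : E) - ε • (w - y) ∈ affineSpan ℝ S := fun ε => by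
    have := AffineMap.lineMap_mem (-ε) y.2 (subset_affineSpan ℝ S hw)
    rwa [AffineMap.lineMap_apply, vsub_eq_sub, vadd_eq_add, neg_smul, neg_add_eq_sub] at this
  let c : ℝ → affineSpan ℝ S := fun ε => ⟨y - ε • (w - y), hmem ε⟩
  have hc : Continuous c := Continuous.subtype_mk (by fun_prop) _
  have hc0 : c 0 = y := Subtype.ext (by simp [c])
  have hev : ∀ᶠ ε in 𝓝 (0 : ℝ), c ε ∈ ((↑) ⁻¹' S : Set (affineSpan ℝ S)) :=
    hc.continuousAt.eventually_mem (by rwa [hc0, ← mem_interior_iff_mem_nhds])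
  exact hev.filter_mono nhdsWithin_le_nhds

/-! ### Extended-real-valued convex functions -/

theorem sum_ne_bot {κ : Type*} {a : κ → EReal} {s : Finset κ} (h : ∀ k ∈ s, a k ≠ ⊥) :
    ∑ k ∈ s, a k ≠ ⊥ :=
  Finset.sum_induction a (· ≠ ⊥) (fun _ _ ha hb => EReal.add_ne_bot_iff.2 ⟨ha, hb⟩)
    EReal.zero_ne_bot h

theorem coe_sum_real {κ : Type*} (s : Finset κ) (a : κ → ℝ) :
    ((∑ k ∈ s, a k : ℝ) : EReal) = ∑ k ∈ s, (a k : EReal) :=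
  map_sum (⟨⟨Real.toEReal, EReal.coe_zero⟩, EReal.coe_add⟩ : ℝ →+ EReal) a s

section Indicator

variable {α β : Type*}

theorem iota_of_mem {S : Set α} {z : α} (h : z ∈ S) : iota S z = 0 := if_pos h

theorem iota_of_notMem {S : Set α} {z : α} (h : z ∉ S) : iota S z = ⊤ := if_neg h

theorem iota_ne_bot (S : Set α) (z : α) : iota S z ≠ ⊥ := by
  by_cases h : z ∈ S <;> simp [iota, h]

theorem effDom_iota (S : Set α) : effDom (iota S) = S := by
  ext z
  by_cases h : z ∈ S <;> simp [effDom, iota, h]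

theorem iota_congr {S : Set α} {T : Set β} {z : α} {w : β} (h : z ∈ S ↔ w ∈ T) :
    iota S z = iota T w := by
  by_cases hz : z ∈ S
  · rw [iota_of_mem hz, iota_of_mem (h.1 hz)]
  · rw [iota_of_notMem hz, iota_of_notMem (mt h.2 hz)]

theorem iota_add_iota (S : Set α) (T : Set β) (z : α) (w : β) :
    iota S z + iota T w = iota (S ×ˢ T) (z, w) := by
  by_cases hz : z ∈ S <;> by_cases hw : w ∈ T <;> simp [iota, hz, hw]

theorem sum_iota {κ : Type*} [Fintype κ] {α : κ → Type*} (S : (k : κ) → Set (α k))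
    (z : (k : κ) → α k) : ∑ k, iota (S k) (z k) = iota (Set.univ.pi S) z := by
  by_cases h : z ∈ Set.univ.pi S
  · rw [iota_of_mem h]
    exact Finset.sum_eq_zero fun k _ => iota_of_mem (h k trivial)
  · obtain ⟨k, hk⟩ : ∃ k, z k ∉ S k := by simpa [Set.mem_univ_pi] using h
    classical
    rw [iota_of_notMem h, ← Finset.add_sum_erase _ _ (Finset.mem_univ k), iota_of_notMem hk,
      EReal.top_add_of_ne_bot (sum_ne_bot fun j _ => iota_ne_bot _ _)]

theorem effDom_add {f g : α → EReal} (hf : ∀ z, f z ≠ ⊥) (hg : ∀ z, g z ≠ ⊥) :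
    effDom (f + g) = effDom f ∩ effDom g := by
  ext z
  simp only [effDom, Set.mem_inter_iff, Set.mem_ofPred_eq, lt_top_iff_ne_top, Pi.add_apply]
  exact EReal.add_ne_top_iff_ne_top₂ (hf z) (hg z)

theorem effDom_sum {κ : Type*} [Fintype κ] {f : κ → α → EReal} (hf : ∀ k z, f k z ≠ ⊥) :
    effDom (∑ k, f k) = ⋂ k, effDom (f k) := by
  classical
  suffices h : ∀ s : Finset κ, effDom (∑ k ∈ s, f k) = ⋂ k ∈ s, effDom (f k) by simp [h]
  intro s
  induction s using Finset.induction_on with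
  | empty => ext; simp [effDom]
  | insert k s hk ih =>
    have hs : ∀ z, (∑ j ∈ s, f j) z ≠ ⊥ := fun z => by
      simpa only [Finset.sum_apply] using sum_ne_bot fun j _ => hf j z
    rw [Finset.sum_insert hk, effDom_add (hf k) hs, ih, Finset.set_biInter_insert]

end Indicator

section Epigraph

/-- The epigraph of an extended-real-valued function; convexity of the function is expressed as
convexity of this set. -/
def epigraph {E : Type*} (f : E → EReal) : Set (E × ℝ) := {p | f p.1 ≤ p.2}

theorem image_fst_epigraph {E : Type*} (f : E → EReal) : Prod.fst '' epigraph f = effDom f := by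
  ext z
  constructor
  · rintro ⟨p, hp, rfl⟩
    exact lt_of_le_of_lt hp (EReal.coe_lt_top _)
  · intro hz
    obtain ⟨t, ht, -⟩ := EReal.lt_iff_exists_real_btwn.1 (show f z < ⊤ from hz)
    exact ⟨(z, t), ht.le, rfl⟩

theorem epigraph_iota {E : Type*} (S : Set E) : epigraph (iota S) = S ×ˢ Set.Ici 0 := by
  ext ⟨z, t⟩
  by_cases h : z ∈ S <;> simp [epigraph, iota, h]

variable {E F : Type*} [AddCommGroup E] [Module ℝ E] [AddCommGroup F] [Module ℝ F]

theorem convex_epigraph_comp {f : F → EReal} (hf : Convex ℝ (epigraph f)) (L : E →ₗ[ℝ] F) :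
    Convex ℝ (epigraph (f ∘ L)) :=
  hf.linear_preimage (L.prodMap LinearMap.id)

theorem convex_epigraph_iota {S : Set E} (hS : Convex ℝ S) : Convex ℝ (epigraph (iota S)) := by
  rw [epigraph_iota]
  exact hS.prod (convex_Ici 0)

theorem exists_real_ge_of_add_le {a b : EReal} {r : ℝ} (ha : a ≠ ⊥) (hb : b ≠ ⊥)
    (h : a + b ≤ r) : ∃ s t : ℝ, a ≤ s ∧ b ≤ t ∧ s + t = r := by
  obtain ⟨ha', hb'⟩ := (EReal.add_ne_top_iff_ne_top₂ ha hb).1 (h.trans_lt (EReal.coe_lt_top r)).ne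
  lift a to ℝ using ⟨ha', ha⟩
  lift b to ℝ using ⟨hb', hb⟩
  norm_cast at h
  exact ⟨a, r - a, le_rfl, by exact_mod_cast le_sub_iff_add_le'.2 h, add_sub_cancel a r⟩

theorem convex_epigraph_add {f g : E → EReal} (hf : Convex ℝ (epigraph f))
    (hg : Convex ℝ (epigraph g)) (hf' : ∀ z, f z ≠ ⊥) (hg' : ∀ z, g z ≠ ⊥) :
    Convex ℝ (epigraph (f + g)) := by
  rintro ⟨x, r⟩ hx ⟨y, r'⟩ hy a b ha hb hab
  obtain ⟨s, t, hs, ht, rfl⟩ := exists_real_ge_of_add_le (hf' x) (hg' x) hx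
  obtain ⟨s', t', hs', ht', rfl⟩ := exists_real_ge_of_add_le (hf' y) (hg' y) hy
  have hfxy : f (a • x + b • y) ≤ ((a • s + b • s' : ℝ) : EReal) :=
    hf (x := (x, s)) hs (y := (y, s')) hs' ha hb hab
  have hgxy : g (a • x + b • y) ≤ ((a • t + b • t' : ℝ) : EReal) :=
    hg (x := (x, t)) ht (y := (y, t')) ht' ha hb hab
  refine (add_le_add hfxy hgxy).trans_eq ?_
  rw [← EReal.coe_add, EReal.coe_eq_coe_iff]
  simp only [Prod.snd_add, Prod.smul_snd, smul_eq_mul]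
  ring

theorem convex_epigraph_sum {κ : Type*} {f : κ → E → EReal} (s : Finset κ)
    (hf : ∀ k ∈ s, Convex ℝ (epigraph (f k))) (hf' : ∀ k ∈ s, ∀ z, f k z ≠ ⊥) :
    Convex ℝ (epigraph (∑ k ∈ s, f k)) := by
  refine (Finset.sum_induction f (fun g => Convex ℝ (epigraph g) ∧ ∀ z, g z ≠ ⊥)
    (fun g h hg hh => ⟨convex_epigraph_add hg.1 hh.1 hg.2 hh.2, fun z =>
      EReal.add_ne_bot_iff.2 ⟨hg.2 z, hh.2 z⟩⟩) ⟨?_, fun _ => EReal.zero_ne_bot⟩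
    fun k hk => ⟨hf k hk, hf' k hk⟩).1
  have h0 : epigraph (0 : E → EReal) = Set.univ ×ˢ Set.Ici 0 := by ext; simp [epigraph]
  rw [h0]
  exact convex_univ.prod (convex_Ici 0)

theorem convex_effDom {f : E → EReal} (hf : Convex ℝ (epigraph f)) : Convex ℝ (effDom f) := by
  rw [← image_fst_epigraph]
  exact hf.linear_image (LinearMap.fst ℝ E ℝ)

theorem exists_linearMap_add_le_of_min {f : E → EReal} (hf : Convex ℝ (epigraph f)) {z : E}
    (hz : f z ≠ ⊤) (hz' : f z ≠ ⊥) {D : Submodule ℝ E} (hmin : ∀ w, w - z ∈ D → f z ≤ f w)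
    {b : E} (hb : b - z ∈ D) (hbf : b ∈ relCore (effDom f)) :
    ∃ φ : E →ₗ[ℝ] ℝ, (∀ d ∈ D, φ d = 0) ∧ ∀ w, f z + (φ (w - z) : ℝ) ≤ f w := by
  rw [← image_fst_epigraph] at hbf
  obtain ⟨a, ha⟩ : ∃ a : ℝ, (a : EReal) = f z := ⟨_, EReal.coe_toReal hz hz'⟩
  obtain ⟨φ, hφD, hφ⟩ := exists_linearMap_le_of_mem_relCore hf (z := z) (a := a) ha.ge
    (fun w t hwt hw => EReal.coe_le_coe_iff.1 (ha.trans_le ((hmin w hw).trans hwt))) hb hbf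
  refine ⟨φ, hφD, fun w => EReal.le_of_forall_lt_iff_le.1 fun t ht => ?_⟩
  rw [← ha, ← EReal.coe_add, EReal.coe_le_coe_iff]
  linarith [hφ w t ht.le]

end Epigraph

theorem IsCCP.lowerSemicontinuous {E : Type*} [AddCommGroup E] [Module ℝ E] [TopologicalSpace E]
    {f : E → EReal} (hf : IsCCP f) : LowerSemicontinuous f := by
  intro z y hy
  obtain ⟨r, hyr, hr⟩ := EReal.lt_iff_exists_real_btwn.1 hy
  have hopen : IsOpen {w | (r : EReal) < f w} := by
    have := (hf.closed_epi.preimage (Continuous.prodMk_left r)).isOpen_compl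
    simpa only [Set.preimage_ofPred_eq, Set.compl_ofPred, not_le] using this
  exact mem_of_superset (hopen.mem_nhds hr) fun w hw => hyr.trans hw

theorem isCCP_iota {E : Type*} [AddCommGroup E] [Module ℝ E] [TopologicalSpace E] {S : Set E}
    (hne : S.Nonempty) (hcl : IsClosed S) (hconv : Convex ℝ S) : IsCCP (iota S) where
  convex_epi := convex_epigraph_iota hconv
  closed_epi := by
    change IsClosed (epigraph (iota S))
    rw [epigraph_iota]
    exact hcl.prod isClosed_Ici
  ne_bot := iota_ne_bot S
  proper := hne.imp fun z hz => by simp [iota_of_mem hz]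

theorem IsCCP.exists_affine_minorant {E : Type*} [NormedAddCommGroup E] [NormedSpace ℝ E]
    [FiniteDimensional ℝ E] {f : E → EReal} (hf : IsCCP f) :
    ∃ (φ : E →ₗ[ℝ] ℝ) (b : ℝ), ∀ w, ((φ w + b : ℝ) : EReal) ≤ f w := by
  have hne : (effDom f).Nonempty := hf.proper.imp fun w hw => lt_top_iff_ne_top.2 hw
  obtain ⟨z, hz⟩ := hne.intrinsicInterior (convex_effDom hf.convex_epi)
  have hzf : f z < ⊤ := show z ∈ effDom f from intrinsicInterior_subset hz
  obtain ⟨φ, -, hφ⟩ := exists_linearMap_add_le_of_min hf.convex_epi hzf.ne (hf.ne_bot z) (D := ⊥)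
    (fun w hw => by rw [sub_eq_zero.1 ((Submodule.mem_bot ℝ).1 hw)]) (b := z) (by simp)
    (intrinsicInterior_subset_relCore _ hz)
  refine ⟨φ, (f z).toReal - φ z, fun w => le_trans (le_of_eq ?_) (hφ w)⟩
  rw [← EReal.coe_toReal hzf.ne (hf.ne_bot z), ← EReal.coe_add, EReal.toReal_coe, map_sub]
  congr 1
  ring

/-! ### Subdifferentials -/

section Subdifferential

variable {ι : Type*} [Fintype ι]

theorem ne_top_of_mem_subdiff {f : (ι → ℝ) → EReal} (hf : ∃ w, f w ≠ ⊤) {z g : ι → ℝ}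
    (hg : g ∈ subdiff f z) : f z ≠ ⊤ := by
  intro hz
  obtain ⟨w, hw⟩ := hf
  have := hg w
  rw [hz, EReal.top_add_coe, top_le_iff] at this
  exact hw this

theorem add_mem_subdiff {f h : (ι → ℝ) → EReal} {z g₁ g₂ : ι → ℝ} (h₁ : g₁ ∈ subdiff f z)
    (h₂ : g₂ ∈ subdiff h z) : g₁ + g₂ ∈ subdiff (f + h) z := fun w => by
  rw [add_dotProduct, EReal.coe_add, Pi.add_apply, add_add_add_comm]
  exact add_le_add (h₁ w) (h₂ w)

theorem mem_subdiff_add_of_invariant {f : (ι → ℝ) → EReal} {v : ι → ℝ}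
    (hv : ∀ w, f (w + v) = f w) {z g : ι → ℝ} (hg : g ∈ subdiff f z) : g ∈ subdiff f (z + v) := by
  intro w
  have := hg (w - v)
  rwa [← hv (w - v), sub_add_cancel, sub_sub, add_comm v, ← hv z] at this

theorem dotProduct_nonpos_of_mem_subdiff {f : (ι → ℝ) → EReal} {z g v : ι → ℝ}
    (hg : g ∈ subdiff f z) (hz : f z ≠ ⊤) (hz' : f z ≠ ⊥) (hv : f (z + v) ≤ f z) :
    g ⬝ᵥ v ≤ 0 := by
  have := (hg (z + v)).trans hv
  lift f z to ℝ using ⟨hz, hz'⟩ with a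
  rw [add_sub_cancel_left, ← EReal.coe_add, EReal.coe_le_coe_iff] at this
  linarith

theorem subdiff_monotone {f : (ι → ℝ) → EReal} (hf : ∀ z, f z ≠ ⊥) (hf' : ∃ z, f z ≠ ⊤)
    {u v g h : ι → ℝ} (hg : g ∈ subdiff f u) (hh : h ∈ subdiff f v) :
    0 ≤ (u - v) ⬝ᵥ (g - h) := by
  have huv := hg v
  have hvu := hh u
  have hu := ne_top_of_mem_subdiff hf' hg
  have hv := ne_top_of_mem_subdiff hf' hh
  lift f u to ℝ using ⟨hu, hf u⟩ with a
  lift f v to ℝ using ⟨hv, hf v⟩ with b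
  norm_cast at huv hvu
  have key : (u - v) ⬝ᵥ (g - h) = -(g ⬝ᵥ (v - u)) - h ⬝ᵥ (u - v) := by
    rw [dotProduct_comm, sub_dotProduct, ← dotProduct_neg, neg_sub]
  linarith

theorem mem_subdiff_iota {S : Set (ι → ℝ)} {z g : ι → ℝ} (hz : z ∈ S) :
    g ∈ subdiff (iota S) z ↔ ∀ w ∈ S, g ⬝ᵥ (w - z) ≤ 0 := by
  rw [subdiff, Set.mem_ofPred_eq, iota_of_mem hz]
  refine forall_congr' fun w => ?_
  by_cases hw : w ∈ S
  · rw [zero_add, iota_of_mem hw, EReal.coe_nonpos, forall_prop_of_true hw]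
  · simp [iota_of_notMem hw, hw]

theorem subdiff_iota_anti {S T : Set (ι → ℝ)} (hST : S ⊆ T) {z : ι → ℝ} (hz : z ∈ S) :
    subdiff (iota T) z ⊆ subdiff (iota S) z := fun _ hg =>
  (mem_subdiff_iota hz).2 fun w hw => (mem_subdiff_iota (hST hz)).1 hg w (hST hw)

theorem exists_dotProduct_eq (φ : (ι → ℝ) →ₗ[ℝ] ℝ) : ∃ g : ι → ℝ, ∀ u, φ u = g ⬝ᵥ u := by
  classical
  refine ⟨(dotProductEquiv ℝ ι).symm φ, fun u => ?_⟩
  rw [← dotProductEquiv_apply_apply, LinearEquiv.apply_symm_apply]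

theorem mem_subdiff_of_add_const_le {f : (ι → ℝ) → EReal} {z g : ι → ℝ} {c : EReal} (hc : c ≠ ⊤)
    (hc' : c ≠ ⊥) (h : ∀ w, f z + c + ((g ⬝ᵥ (w - z) : ℝ) : EReal) ≤ f w + c) :
    g ∈ subdiff f z := fun w => by
  lift c to ℝ using ⟨hc, hc'⟩
  have := h w
  rw [add_right_comm] at this
  exact (EReal.addLECancellable_coe c).add_le_add_iff_right.1 this

/-- A Fenchel-Rockafellar rule. The two summands are given independent arguments, so that one
functional on the product, vanishing on the diagonal of `D`, supplies both subgradients. -/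
theorem exists_mem_subdiff_of_min_add {f h : (ι → ℝ) → EReal} (hf : Convex ℝ (epigraph f))
    (hh : Convex ℝ (epigraph h)) (hf' : ∀ z, f z ≠ ⊥) (hh' : ∀ z, h z ≠ ⊥)
    {D : Submodule ℝ (ι → ℝ)} {z : ι → ℝ} (hfz : f z ≠ ⊤) (hhz : h z ≠ ⊤)
    (hmin : ∀ w, w - z ∈ D → f z + h z ≤ f w + h w) {b : ι → ℝ} (hb : b - z ∈ D)
    (hbf : b ∈ relCore (effDom f)) (hbh : b ∈ relCore (effDom h)) :
    ∃ g₁ ∈ subdiff f z, ∃ g₂ ∈ subdiff h z, ∀ d ∈ D, (g₁ + g₂) ⬝ᵥ d = 0 := by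
  let π₁ := LinearMap.fst ℝ (ι → ℝ) (ι → ℝ)
  let π₂ := LinearMap.snd ℝ (ι → ℝ) (ι → ℝ)
  let f₂ : (ι → ℝ) × (ι → ℝ) → EReal := f ∘ π₁ + h ∘ π₂
  have hconv : Convex ℝ (epigraph f₂) := convex_epigraph_add (convex_epigraph_comp hf π₁)
    (convex_epigraph_comp hh π₂) (fun _ => hf' _) fun _ => hh' _
  have hcore : (b, b) ∈ relCore (effDom f₂) := by
    rw [effDom_add (f := f ∘ π₁) (g := h ∘ π₂) (fun _ => hf' _) fun _ => hh' _]
    exact mem_relCore_inter (mem_relCore_preimage π₁ (S := effDom f) hbf)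
      (mem_relCore_preimage π₂ (S := effDom h) hbh)
  obtain ⟨φ, hφD, hφ⟩ := exists_linearMap_add_le_of_min hconv (z := (z, z))
    ((EReal.add_ne_top_iff_ne_top₂ (hf' z) (hh' z)).2 ⟨hfz, hhz⟩)
    (EReal.add_ne_bot_iff.2 ⟨hf' z, hh' z⟩) (D := D.map (LinearMap.id.prod LinearMap.id))
    (by
      rintro ⟨w₁, w₂⟩ ⟨d, hd, hw⟩
      obtain ⟨rfl, hw₂⟩ : d = w₁ - z ∧ d = w₂ - z := Prod.mk_inj.1 hw
      obtain rfl := sub_left_inj.1 hw₂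
      exact hmin w₁ hd)
    ⟨b - z, hb, rfl⟩ hcore
  obtain ⟨g₁, hg₁⟩ := exists_dotProduct_eq (φ ∘ₗ LinearMap.inl ℝ _ _)
  obtain ⟨g₂, hg₂⟩ := exists_dotProduct_eq (φ ∘ₗ LinearMap.inr ℝ _ _)
  refine ⟨g₁, mem_subdiff_of_add_const_le hhz (hh' z) fun w => ?_, g₂,
    mem_subdiff_of_add_const_le hfz (hf' z) fun w => ?_, fun d hd => ?_⟩
  · simpa [f₂, π₁, π₂, ← hg₁] using hφ (w, z)
  · simpa [f₂, π₁, π₂, ← hg₂, add_comm (h _)] using hφ (z, w)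
  · rw [add_dotProduct, ← hg₁, ← hg₂, LinearMap.comp_apply, LinearMap.comp_apply, ← map_add]
    simpa using hφD (d, d) ⟨d, hd, rfl⟩

theorem exists_transpose_mulVec_eq {κ : Type*} [Fintype κ] (M : Matrix κ ι ℝ) {g : ι → ℝ}
    (hg : ∀ d, M *ᵥ d = 0 → g ⬝ᵥ d = 0) : ∃ y, Mᵀ *ᵥ y = g := by
  have hann : dotProductBilin ℝ ℝ g ∈ (LinearMap.ker M.mulVecLin).dualAnnihilator :=
    (Submodule.mem_dualAnnihilator _).2 hg
  rw [← LinearMap.range_dualMap_eq_dualAnnihilator_ker] at hann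
  obtain ⟨φ, hφ⟩ := hann
  obtain ⟨y, hy⟩ := exists_dotProduct_eq φ
  refine ⟨y, dotProduct_eq _ _ fun u => ?_⟩
  rw [Matrix.mulVec_transpose, ← Matrix.dotProduct_mulVec, ← hy]
  exact LinearMap.congr_fun hφ u

end Subdifferential

/-! ### Minimizers of regularized convex functions -/

section QuadraticExpansion

variable {E : Type*} [AddCommGroup E] [Module ℝ E]

/-- `h` is a quadratic polynomial, whose expansion at `z` has the linear part `φ` and the
quadratic part `Q`. -/
def HasQuadraticExpansion (h : E → ℝ) (z : E) (φ : E →ₗ[ℝ] ℝ) (Q : QuadraticForm ℝ E) : Prop :=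
  ∀ d, h (z + d) = h z + φ d + Q d

theorem HasQuadraticExpansion.add_linearMap {h : E → ℝ} {z : E} {φ : E →ₗ[ℝ] ℝ}
    {Q : QuadraticForm ℝ E} (hh : HasQuadraticExpansion h z φ Q) (ψ : E →ₗ[ℝ] ℝ) :
    HasQuadraticExpansion (fun w => h w + ψ w) z (φ + ψ) Q := fun d => by
  simp only [hh d, map_add, LinearMap.add_apply]
  ring

theorem HasQuadraticExpansion.eq_sub {h : E → ℝ} {z : E} {φ : E →ₗ[ℝ] ℝ} {Q : QuadraticForm ℝ E}
    (hh : HasQuadraticExpansion h z φ Q) (w : E) : h w = h z + φ (w - z) + Q (w - z) := by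
  rw [← hh, add_sub_cancel]

/-- The quadratic form of `sqNorm`. -/
def sqForm (ι : Type*) [Fintype ι] : QuadraticForm ℝ (ι → ℝ) :=
  LinearMap.BilinMap.toQuadraticMap (dotProductBilin ℝ ℝ)

theorem sqForm_apply {ι : Type*} [Fintype ι] (v : ι → ℝ) : sqForm ι v = sqNorm v := rfl

theorem posDef_sqForm (ι : Type*) [Fintype ι] : (sqForm ι).PosDef := fun v hv =>
  lt_of_le_of_ne (Finset.sum_nonneg fun i _ => mul_self_nonneg (v i))
    fun h => hv (dotProduct_self_eq_zero.1 h.symm)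

theorem sqNorm_add {ι : Type*} [Fintype ι] (u v : ι → ℝ) :
    sqNorm (u + v) = sqNorm u + 2 * (u ⬝ᵥ v) + sqNorm v := by
  simp only [sqNorm, add_dotProduct, dotProduct_add, dotProduct_comm v u]
  ring

theorem IsCCP.sub_le_of_isMinOn_add [TopologicalSpace E] {f : E → EReal} (hf : IsCCP f) {h : E → ℝ}
    {z : E} {φ : E →ₗ[ℝ] ℝ} {Q : QuadraticForm ℝ E} (hh : HasQuadraticExpansion h z φ Q)
    (hz : IsMinOn (fun w => f w + (h w : EReal)) Set.univ z) (w : E) :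
    f z + (-φ (w - z) : ℝ) ≤ f w := by
  have hmin : ∀ w, f z + (h z : EReal) ≤ f w + (h w : EReal) := fun w => hz (Set.mem_univ w)
  have hfz : f z ≠ ⊤ := fun htop => by
    obtain ⟨w, hw⟩ := hf.proper
    have := hmin w
    rw [htop, EReal.top_add_coe, top_le_iff] at this
    exact EReal.add_ne_top hw (EReal.coe_ne_top _) this
  rcases eq_or_ne (f w) ⊤ with hw | hw
  · exact hw ▸ le_top
  obtain ⟨a, ha⟩ : ∃ a : ℝ, f z = a := ⟨_, (EReal.coe_toReal hfz (hf.ne_bot z)).symm⟩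
  obtain ⟨b, hb⟩ : ∃ b : ℝ, f w = b := ⟨_, (EReal.coe_toReal hw (hf.ne_bot w)).symm⟩
  have hsegment : ∀ s ∈ Set.Ioc (0 : ℝ) 1, a - b ≤ φ (w - z) + s * Q (w - z) := by
    intro s hs
    have hs' := hf.convex_epi.add_smul_sub_mem (x := (z, a)) (y := (w, b)) ha.le hb.le
      ⟨hs.1.le, hs.2⟩
    have hle := (hmin (z + s • (w - z))).trans (add_le_add_left hs' _)
    rw [hh, ha, map_smul, QuadraticMap.map_smul] at hle
    simp only [Prod.snd_add, Prod.smul_snd, Prod.snd_sub, smul_eq_mul] at hle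
    norm_cast at hle
    nlinarith [hs.1, hle]
  have hlim : Tendsto (fun s : ℝ => φ (w - z) + s * Q (w - z)) (𝓝[>] 0)
      (𝓝 (φ (w - z) + 0 * Q (w - z))) :=
    (Continuous.tendsto (by fun_prop) 0).mono_left nhdsWithin_le_nhds
  have hle : a - b ≤ φ (w - z) + 0 * Q (w - z) :=
    ge_of_tendsto hlim (eventually_of_mem (Ioc_mem_nhdsGT one_pos) hsegment)
  rw [ha, hb]
  exact_mod_cast (by linarith : a + -φ (w - z) ≤ b)

end QuadraticExpansion

section Coercivity

variable {E : Type*} [NormedAddCommGroup E] [NormedSpace ℝ E] [FiniteDimensional ℝ E]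

theorem continuous_quadraticForm (Q : QuadraticForm ℝ E) : Continuous Q := by
  obtain ⟨B, rfl⟩ := LinearMap.BilinMap.toQuadraticMap_surjective Q
  exact B.toContinuousBilinearMap.continuous₂.comp (continuous_id.prodMk continuous_id)

theorem exists_mul_norm_sq_le_of_posDef {Q : QuadraticForm ℝ E} (hQ : Q.PosDef) :
    ∃ κ > 0, ∀ d, κ * ‖d‖ ^ 2 ≤ Q d := by
  rcases subsingleton_or_nontrivial E with hE | hE
  · exact ⟨1, one_pos, fun d => by simp [Subsingleton.elim d 0]⟩
  have : (Metric.sphere (0 : E) 1).Nonempty := NormedSpace.sphere_nonempty.2 zero_le_one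
  obtain ⟨u, hu, hmin⟩ := (isCompact_sphere (0 : E) 1).exists_isMinOn this
    (continuous_quadraticForm Q).continuousOn
  refine ⟨Q u, hQ u (ne_zero_of_mem_unit_sphere ⟨u, hu⟩), fun d => ?_⟩
  rcases eq_or_ne d 0 with rfl | hd
  · simp
  have hdpos : 0 < ‖d‖ := norm_pos_iff.2 hd
  have hsphere : ‖d‖⁻¹ • d ∈ Metric.sphere (0 : E) 1 := by
    simp [norm_smul, hdpos.ne']
  calc Q u * ‖d‖ ^ 2 ≤ Q (‖d‖⁻¹ • d) * ‖d‖ ^ 2 := by gcongr; exact hmin hsphere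
    _ = Q d := by
      rw [QuadraticMap.map_smul, smul_eq_mul]
      field_simp

variable {h : E → ℝ} {z : E} {φ : E →ₗ[ℝ] ℝ} {Q : QuadraticForm ℝ E}

theorem HasQuadraticExpansion.continuous (hh : HasQuadraticExpansion h z φ Q) : Continuous h := by
  have hQ := continuous_quadraticForm Q
  have hφ := φ.continuous_of_finiteDimensional
  rw [funext hh.eq_sub]
  fun_prop

theorem HasQuadraticExpansion.tendsto_cocompact (hh : HasQuadraticExpansion h z φ Q)
    (hQ : Q.PosDef) : Tendsto h (cocompact E) atTop := by
  obtain ⟨κ, hκ, hκQ⟩ := exists_mul_norm_sq_le_of_posDef hQ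
  set ℓ := LinearMap.toContinuousLinearMap φ
  have hbound : ∀ w, h z + ‖w - z‖ * (κ * ‖w - z‖ - ‖ℓ‖) ≤ h w := fun w => by
    have hℓ : -(‖ℓ‖ * ‖w - z‖) ≤ φ (w - z) := (abs_le.1 (ℓ.le_opNorm (w - z))).1
    rw [hh.eq_sub w]
    linarith [hκQ (w - z)]
  have hnorm : Tendsto (fun w : E => ‖w - z‖) (cocompact E) atTop := by
    simpa [dist_eq_norm] using tendsto_dist_right_cocompact_atTop z
  refine tendsto_atTop_mono hbound (tendsto_atTop_add_const_left _ _ (hnorm.atTop_mul_atTop₀ ?_))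
  exact tendsto_atTop_add_const_right _ _ (hnorm.const_mul_atTop hκ)

/-- Adding the affine minorant of `f` to `h` leaves a positive definite quadratic polynomial below
`f + h`, so the sublevel sets of `f + h` are bounded. -/
theorem IsCCP.exists_isMinOn_add {f : E → EReal} (hf : IsCCP f)
    (hh : HasQuadraticExpansion h z φ Q) (hQ : Q.PosDef) :
    ∃ w, IsMinOn (fun w => f w + (h w : EReal)) Set.univ w := by
  obtain ⟨ψ, b, hψ⟩ := hf.exists_affine_minorant
  obtain ⟨w₀, hw₀⟩ := hf.proper
  have hlsc : LowerSemicontinuous fun w => f w + (h w : EReal) :=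
    hf.lowerSemicontinuous.add'
      (continuous_coe_real_ereal.comp hh.continuous).lowerSemicontinuous fun w =>
      EReal.continuousAt_add (.inr (EReal.coe_ne_bot _)) (.inr (EReal.coe_ne_top _))
  have hcoercive : ∀ᶠ w in cocompact E, f w₀ + (h w₀ : EReal) ≤ f w + (h w : EReal) := by
    have hlim := (hh.add_linearMap ψ).tendsto_cocompact hQ
    filter_upwards [hlim.eventually_ge_atTop ((f w₀).toReal + h w₀ - b)] with w _
    calc f w₀ + (h w₀ : EReal) = (((f w₀).toReal + h w₀ : ℝ) : EReal) := by
          rw [EReal.coe_add, EReal.coe_toReal hw₀ (hf.ne_bot w₀)]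
      _ ≤ ((ψ w + b + h w : ℝ) : EReal) := by exact_mod_cast (by linarith)
      _ ≤ f w + (h w : EReal) := by
          rw [EReal.coe_add]
          exact add_le_add_left (hψ w) _
  obtain ⟨K, hK, hKw⟩ := mem_cocompact.1 hcoercive
  obtain ⟨w, -, hmin⟩ := (hlsc.lowerSemicontinuousOn _).exists_isMinOn
    (Set.insert_nonempty w₀ K) (hK.insert w₀)
  refine ⟨w, fun v _ => ?_⟩
  by_cases hv : v ∈ K
  · exact hmin (Set.mem_insert_of_mem w₀ hv)
  · have hv' : f w₀ + (h w₀ : EReal) ≤ f v + (h v : EReal) := hKw hv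
    exact (hmin (Set.mem_insert w₀ K)).trans hv'

end Coercivity

theorem isMinOn_iota_add_iff {α : Type*} {S : Set α} (hS : S.Nonempty) {h : α → ℝ} {z : α} :
    IsMinOn (fun w => iota S w + (h w : EReal)) Set.univ z ↔ z ∈ S ∧ IsMinOn h S z := by
  constructor
  · intro hz
    have hzS : z ∈ S := by
      by_contra hzS
      obtain ⟨w, hw⟩ := hS
      have := hz (Set.mem_univ w)
      simp [iota_of_mem hw, iota_of_notMem hzS] at this
    refine ⟨hzS, fun w hw => ?_⟩
    have := hz (Set.mem_univ w)
    simpa [iota_of_mem hw, iota_of_mem hzS] using this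
  · rintro ⟨hzS, hz⟩ w -
    by_cases hw : w ∈ S
    · simpa [iota_of_mem hw, iota_of_mem hzS] using hz hw
    · simp [iota_of_notMem hw]

/-! ### Krasnoselskii-Mann iteration -/

section KrasnoselskiiMann

variable {H : Type*} [NormedAddCommGroup H] {R : H → H} {γ : ℕ → ℝ} {z : ℕ → H}

section NormedSpace

variable [NormedSpace ℝ H]

theorem antitone_norm_residual (hR : LipschitzWith 1 R) (hγ : ∀ k, γ k ∈ Set.Icc (0 : ℝ) 1)
    (hz : ∀ k, z (k + 1) = z k + γ k • (R (z k) - z k)) :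
    Antitone fun k => ‖R (z k) - z k‖ := by
  refine antitone_nat_of_succ_le fun k => ?_
  have hR' : ‖R (z (k + 1)) - R (z k)‖ ≤ γ k * ‖R (z k) - z k‖ := by
    refine (hR.norm_sub_le _ _).trans_eq ?_
    rw [NNReal.coe_one, one_mul, hz k, add_sub_cancel_left, norm_smul,
      Real.norm_of_nonneg (hγ k).1]
  calc ‖R (z (k + 1)) - z (k + 1)‖
      = ‖(R (z (k + 1)) - R (z k)) + (1 - γ k) • (R (z k) - z k)‖ := by
        congr 1
        nth_rewrite 2 [hz k]
        module
    _ ≤ γ k * ‖R (z k) - z k‖ + (1 - γ k) * ‖R (z k) - z k‖ := by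
        refine (norm_add_le _ _).trans (add_le_add hR' ?_)
        rw [norm_smul, Real.norm_of_nonneg (sub_nonneg.2 (hγ k).2)]
    _ = ‖R (z k) - z k‖ := by ring

end NormedSpace

variable [InnerProductSpace ℝ H]

theorem norm_sq_add_smul_sub (u v : H) (t : ℝ) :
    ‖u + t • (v - u)‖ ^ 2 = (1 - t) * ‖u‖ ^ 2 + t * ‖v‖ ^ 2 - t * (1 - t) * ‖v - u‖ ^ 2 := by
  simp only [← real_inner_self_eq_norm_sq, inner_add_left, inner_add_right, inner_sub_left,
    inner_sub_right, real_inner_smul_left, real_inner_smul_right, real_inner_comm u v]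
  ring

theorem norm_sq_relaxation_sub_le (hR : LipschitzWith 1 R) {p : H} (hp : R p = p) {t : ℝ}
    (ht : 0 ≤ t) (x : H) :
    ‖x + t • (R x - x) - p‖ ^ 2 ≤ ‖x - p‖ ^ 2 - t * (1 - t) * ‖R x - x‖ ^ 2 := by
  have hRx : ‖R x - p‖ ^ 2 ≤ ‖x - p‖ ^ 2 := by
    have := hR.norm_sub_le x p
    rw [hp, NNReal.coe_one, one_mul] at this
    gcongr
  have hexpand := norm_sq_add_smul_sub (x - p) (R x - p) t
  rw [sub_sub_sub_cancel_right, sub_add_eq_add_sub] at hexpand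
  nlinarith

theorem antitone_norm_sub_fixedPoint (hR : LipschitzWith 1 R)
    (hγ : ∀ k, γ k ∈ Set.Icc (0 : ℝ) 1) (hz : ∀ k, z (k + 1) = z k + γ k • (R (z k) - z k))
    {p : H} (hp : R p = p) : Antitone fun k => ‖z k - p‖ := by
  refine antitone_nat_of_succ_le fun k => (sq_le_sq₀ (norm_nonneg _) (norm_nonneg _)).1 ?_
  have hnonneg : 0 ≤ γ k * (1 - γ k) * ‖R (z k) - z k‖ ^ 2 :=
    mul_nonneg (mul_nonneg (hγ k).1 (sub_nonneg.2 (hγ k).2)) (sq_nonneg _)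
  rw [hz k]
  linarith [norm_sq_relaxation_sub_le hR hp (hγ k).1 (z k)]

theorem sum_mul_norm_sq_residual_le (hR : LipschitzWith 1 R)
    (hγ : ∀ k, γ k ∈ Set.Icc (0 : ℝ) 1) (hz : ∀ k, z (k + 1) = z k + γ k • (R (z k) - z k))
    {p : H} (hp : R p = p) (m : ℕ) :
    (∑ k ∈ Finset.range m, γ k * (1 - γ k)) * ‖R (z m) - z m‖ ^ 2 ≤ ‖z 0 - p‖ ^ 2 := by
  have hstep : ∀ k ∈ Finset.range m, γ k * (1 - γ k) * ‖R (z m) - z m‖ ^ 2 ≤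
      ‖z k - p‖ ^ 2 - ‖z (k + 1) - p‖ ^ 2 := fun k hk => by
    have hres : ‖R (z m) - z m‖ ≤ ‖R (z k) - z k‖ :=
      antitone_norm_residual hR hγ hz (Finset.mem_range.1 hk).le
    have hγk : 0 ≤ γ k * (1 - γ k) := mul_nonneg (hγ k).1 (sub_nonneg.2 (hγ k).2)
    calc γ k * (1 - γ k) * ‖R (z m) - z m‖ ^ 2
        ≤ γ k * (1 - γ k) * ‖R (z k) - z k‖ ^ 2 := by gcongr
      _ ≤ ‖z k - p‖ ^ 2 - ‖z (k + 1) - p‖ ^ 2 := by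
        rw [hz k]
        linarith [norm_sq_relaxation_sub_le hR hp (hγ k).1 (z k)]
  calc (∑ k ∈ Finset.range m, γ k * (1 - γ k)) * ‖R (z m) - z m‖ ^ 2
      ≤ ∑ k ∈ Finset.range m, (‖z k - p‖ ^ 2 - ‖z (k + 1) - p‖ ^ 2) := by
        rw [Finset.sum_mul]
        exact Finset.sum_le_sum hstep
    _ = ‖z 0 - p‖ ^ 2 - ‖z m - p‖ ^ 2 := Finset.sum_range_sub' _ m
    _ ≤ ‖z 0 - p‖ ^ 2 := sub_le_self _ (sq_nonneg _)

theorem tendsto_residual (hR : LipschitzWith 1 R) (hγ : ∀ k, γ k ∈ Set.Icc (0 : ℝ) 1)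
    (hγsum : Tendsto (fun m => ∑ k ∈ Finset.range m, γ k * (1 - γ k)) atTop atTop)
    (hz : ∀ k, z (k + 1) = z k + γ k • (R (z k) - z k)) {p : H} (hp : R p = p) :
    Tendsto (fun k => R (z k) - z k) atTop (𝓝 0) := by
  have hsq : Tendsto (fun k => ‖R (z k) - z k‖ ^ 2) atTop (𝓝 0) := by
    refine squeeze_zero' (.of_forall fun _ => sq_nonneg _) ?_
      (hγsum.const_div_atTop (‖z 0 - p‖ ^ 2))
    filter_upwards [hγsum.eventually_gt_atTop 0] with m hm
    rw [le_div_iff₀ hm, mul_comm]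
    exact sum_mul_norm_sq_residual_le hR hγ hz hp m
  rw [tendsto_zero_iff_norm_tendsto_zero]
  simpa using hsq.sqrt

theorem exists_tendsto_krasnoselskiiMann [ProperSpace H] (hR : LipschitzWith 1 R)
    (hγ : ∀ k, γ k ∈ Set.Icc (0 : ℝ) 1)
    (hγsum : Tendsto (fun m => ∑ k ∈ Finset.range m, γ k * (1 - γ k)) atTop atTop)
    (hz : ∀ k, z (k + 1) = z k + γ k • (R (z k) - z k)) (hfix : ∃ p, R p = p) :
    ∃ p, R p = p ∧ Tendsto z atTop (𝓝 p) := by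
  obtain ⟨q, hq⟩ := hfix
  have hbdd : ∀ k, z k ∈ Metric.closedBall q ‖z 0 - q‖ := fun k => by
    rw [mem_closedBall_iff_norm]
    exact antitone_norm_sub_fixedPoint hR hγ hz hq (Nat.zero_le k)
  obtain ⟨p, -, s, hs, hsp⟩ := tendsto_subseq_of_bounded Metric.isBounded_closedBall hbdd
  have hp : R p = p := by
    have hlim : Tendsto (fun k => R (z (s k)) - z (s k)) atTop (𝓝 (R p - p)) :=
      ((hR.continuous.tendsto p).comp hsp).sub hsp
    exact sub_eq_zero.1 (tendsto_nhds_unique hlim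
      ((tendsto_residual hR hγ hγsum hz hq).comp hs.tendsto_atTop))
  refine ⟨p, hp, ?_⟩
  rw [tendsto_iff_norm_sub_tendsto_zero] at hsp ⊢
  exact (tendsto_iff_tendsto_subseq_of_antitone (antitone_norm_sub_fixedPoint hR hγ hz hp)
    hs.tendsto_atTop).2 hsp

end KrasnoselskiiMann

/-! ### Splitting of monotone operators -/

section MonotoneOperators

/-- Monotone set-valued operators on a real vector space with the pairing `B`. -/
def IsMonotoneOp {E : Type*} [AddCommGroup E] [Module ℝ E] (B : LinearMap.BilinForm ℝ E)
    (A : E → Set E) : Prop :=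
  ∀ ⦃u g v h : E⦄, g ∈ A u → h ∈ A v → 0 ≤ B (u - v) (g - h)

/-- `J = (Id + A)⁻¹`, as a relation between a map and a set-valued operator. -/
def IsResolvent {E : Type*} [AddCommGroup E] (A : E → Set E) (J : E → E) : Prop :=
  ∀ z, z - J z ∈ A (J z)

/-- The reflected resolvent `2 J - Id`. -/
def reflected {E : Type*} [AddCommGroup E] [Module ℝ E] (J : E → E) (z : E) : E :=
  (2 : ℝ) • J z - z

variable {H : Type*} [NormedAddCommGroup H] [InnerProductSpace ℝ H] {A B : H → Set H}
  {JA JB : H → H}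

theorem IsMonotoneOp.norm_sq_sub_le (hA : IsMonotoneOp (innerₗ H) A) {z z' u u' : H}
    (hu : z - u ∈ A u) (hu' : z' - u' ∈ A u') : ‖u - u'‖ ^ 2 ≤ inner ℝ (u - u') (z - z') := by
  have hmono := hA hu hu'
  rwa [innerₗ_apply_apply, sub_sub_sub_comm, inner_sub_right, real_inner_self_eq_norm_sq,
    sub_nonneg] at hmono

theorem IsMonotoneOp.norm_sub_le (hA : IsMonotoneOp (innerₗ H) A) {z z' u u' : H}
    (hu : z - u ∈ A u) (hu' : z' - u' ∈ A u') : ‖u - u'‖ ≤ ‖z - z'‖ := by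
  have := (hA.norm_sq_sub_le hu hu').trans (real_inner_le_norm _ _)
  rw [sq] at this
  rcases (norm_nonneg (u - u')).eq_or_lt with h | h
  · exact h ▸ norm_nonneg _
  · exact le_of_mul_le_mul_left this h

theorem IsMonotoneOp.eq_resolvent (hA : IsMonotoneOp (innerₗ H) A) (hJA : IsResolvent A JA)
    {z u : H} (hu : z - u ∈ A u) : u = JA z := by
  have := hA.norm_sub_le hu (hJA z)
  rwa [sub_self, norm_zero, norm_le_zero_iff, sub_eq_zero] at this

theorem IsMonotoneOp.lipschitzWith_resolvent (hA : IsMonotoneOp (innerₗ H) A)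
    (hJA : IsResolvent A JA) : LipschitzWith 1 JA :=
  .of_dist_le_mul fun z z' => by
    simpa [dist_eq_norm] using hA.norm_sub_le (hJA z) (hJA z')

theorem IsMonotoneOp.lipschitzWith_reflected (hA : IsMonotoneOp (innerₗ H) A)
    (hJA : IsResolvent A JA) : LipschitzWith 1 (reflected JA) :=
  .of_dist_le_mul fun z z' => by
    rw [dist_eq_norm, dist_eq_norm, NNReal.coe_one, one_mul]
    refine (sq_le_sq₀ (norm_nonneg _) (norm_nonneg _)).1 ?_
    have hfirm := hA.norm_sq_sub_le (hJA z) (hJA z')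
    calc ‖reflected JA z - reflected JA z'‖ ^ 2
        = ‖(2 : ℝ) • (JA z - JA z') - (z - z')‖ ^ 2 := by
          congr 2
          simp only [reflected]
          module
      _ = 4 * ‖JA z - JA z'‖ ^ 2 - 4 * inner ℝ (JA z - JA z') (z - z') + ‖z - z'‖ ^ 2 := by
          rw [norm_sub_sq_real, norm_smul, real_inner_smul_left, Real.norm_ofNat]
          ring
      _ ≤ ‖z - z'‖ ^ 2 := by linarith

theorem reflected_reflected_eq (z : H) :
    reflected JB (reflected JA z) = z + (2 : ℝ) • (JB (reflected JA z) - JA z) := by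
  simp only [reflected]
  module

theorem IsMonotoneOp.reflected_reflected_of_zero (hA : IsMonotoneOp (innerₗ H) A)
    (hB : IsMonotoneOp (innerₗ H) B) (hJA : IsResolvent A JA) (hJB : IsResolvent B JB) {p g : H}
    (hgA : g ∈ A p) (hgB : -g ∈ B p) : reflected JB (reflected JA (p + g)) = p + g := by
  have hpA : p = JA (p + g) := hA.eq_resolvent hJA (by rwa [add_sub_cancel_left])
  have hrefl : reflected JA (p + g) = p - g := by
    rw [reflected, ← hpA]
    module
  have hpB : p = JB (p - g) := hB.eq_resolvent hJB (by rwa [sub_sub_cancel_left])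
  rw [reflected_reflected_eq, hrefl, ← hpA, ← hpB, sub_self, smul_zero, add_zero]

theorem IsResolvent.neg_mem_of_reflected_reflected_eq (hJB : IsResolvent B JB) {z : H}
    (hz : reflected JB (reflected JA z) = z) : -(z - JA z) ∈ B (JA z) := by
  have hJ : JB (reflected JA z) = JA z := by
    rw [reflected_reflected_eq, add_eq_left, smul_eq_zero, sub_eq_zero] at hz
    exact hz.resolve_left two_ne_zero
  have := hJB (reflected JA z)
  rw [hJ] at this
  convert this using 1
  simp only [reflected]
  module

theorem tendsto_peacemanRachford [ProperSpace H] (hA : IsMonotoneOp (innerₗ H) A)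
    (hB : IsMonotoneOp (innerₗ H) B) (hJA : IsResolvent A JA) (hJB : IsResolvent B JB)
    (hzero : ∃ p, ∃ g ∈ A p, -g ∈ B p) {γ : ℕ → ℝ} (hγ : ∀ k, γ k ∈ Set.Icc (0 : ℝ) 1)
    (hγsum : Tendsto (fun m => ∑ k ∈ Finset.range m, γ k * (1 - γ k)) atTop atTop)
    {z : ℕ → H} (hz : ∀ k, z (k + 1) = z k + (2 * γ k) • (JB (reflected JA (z k)) - JA (z k))) :
    ∃ p, (∃ g ∈ A p, -g ∈ B p) ∧ Tendsto (fun k => JA (z k)) atTop (𝓝 p) := by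
  obtain ⟨p₀, g₀, hgA, hgB⟩ := hzero
  have hlip : LipschitzWith 1 (reflected JB ∘ reflected JA) := by
    simpa using (hB.lipschitzWith_reflected hJB).comp (hA.lipschitzWith_reflected hJA)
  obtain ⟨q, hq, hlim⟩ := exists_tendsto_krasnoselskiiMann hlip hγ hγsum (z := z)
    (fun k => by
      rw [hz k, Function.comp_apply, reflected_reflected_eq, add_sub_cancel_left, smul_smul,
        mul_comm])
    ⟨p₀ + g₀, hA.reflected_reflected_of_zero hB hJA hJB hgA hgB⟩
  exact ⟨JA q, ⟨q - JA q, hJA q, hJB.neg_mem_of_reflected_reflected_eq hq⟩,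
    ((hA.lipschitzWith_resolvent hJA).continuous.tendsto q).comp hlim⟩

end MonotoneOperators

section Splitting

variable {ι : Type*} [Fintype ι]

open scoped MatrixOrder ComplexOrder in
theorem exists_equiv_euclideanSpace_of_posDef {Φ : Matrix ι ι ℝ} (hΦ : Φ.PosDef) :
    ∃ e : (ι → ℝ) ≃L[ℝ] EuclideanSpace ℝ ι, ∀ u v, inner ℝ (e u) (e v) = u ⬝ᵥ Φ *ᵥ v := by
  classical
  obtain ⟨B, hB⟩ := CStarAlgebra.nonneg_iff_eq_star_mul_self.1
    (Matrix.nonneg_iff_posSemidef.2 hΦ.posSemidef)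
  let f : (ι → ℝ) →ₗ[ℝ] EuclideanSpace ℝ ι :=
    (WithLp.linearEquiv 2 ℝ (ι → ℝ)).symm.toLinearMap ∘ₗ B.mulVecLin
  have hf : ∀ u v, inner ℝ (f u) (f v) = u ⬝ᵥ Φ *ᵥ v := fun u v => by
    rw [hB, ← Matrix.mulVec_mulVec, Matrix.dotProduct_mulVec, Matrix.star_eq_conjTranspose,
      Matrix.conjTranspose_eq_transpose_of_trivial, Matrix.vecMul_transpose]
    simp [f, EuclideanSpace.inner_eq_star_dotProduct, dotProduct_comm]
  have hinj : Function.Injective f := (injective_iff_map_eq_zero f).2 fun u hu => by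
    by_contra hne
    have hpos : 0 < u ⬝ᵥ Φ *ᵥ u := hΦ.dotProduct_mulVec_pos hne
    rw [← hf, hu, inner_zero_left] at hpos
    exact hpos.false
  exact ⟨(LinearEquiv.ofInjectiveOfFinrankEq f hinj (by simp)).toContinuousLinearEquiv, hf⟩

/-- The operator `Φ⁻¹ A`, transported to `H` along `e`; it is monotone there if `A` is monotone and
`e` turns the pairing `u ⬝ᵥ Φ *ᵥ v` into the inner product. -/
def metricOp {H : Type*} [NormedAddCommGroup H] [NormedSpace ℝ H] (Φ : Matrix ι ι ℝ)
    (e : (ι → ℝ) ≃L[ℝ] H) (A : (ι → ℝ) → Set (ι → ℝ)) (x : H) : Set H :=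
  {y | Φ *ᵥ e.symm y ∈ A (e.symm x)}

theorem IsMonotoneOp.metricOp {H : Type*} [NormedAddCommGroup H] [InnerProductSpace ℝ H]
    {Φ : Matrix ι ι ℝ} {e : (ι → ℝ) ≃L[ℝ] H} (he : ∀ u v, inner ℝ (e u) (e v) = u ⬝ᵥ Φ *ᵥ v)
    {A : (ι → ℝ) → Set (ι → ℝ)} (hA : IsMonotoneOp (dotProductBilin ℝ ℝ) A) :
    IsMonotoneOp (innerₗ H) (metricOp Φ e A) := fun u g v h hg hh => by
  have := hA hg hh
  rwa [dotProductBilin_apply_apply, ← Matrix.mulVec_sub, ← map_sub, ← map_sub, ← he,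
    e.apply_symm_apply, e.apply_symm_apply] at this

theorem tendsto_relaxed_splitting {Φ : Matrix ι ι ℝ} (hΦ : Φ.PosDef)
    {A B : (ι → ℝ) → Set (ι → ℝ)} (hA : IsMonotoneOp (dotProductBilin ℝ ℝ) A)
    (hB : IsMonotoneOp (dotProductBilin ℝ ℝ) B) (hA' : ∀ z, ∃ u, Φ *ᵥ (z - u) ∈ A u)
    (hB' : ∀ z, ∃ u, Φ *ᵥ (z - u) ∈ B u) (hzero : ∃ p, ∃ g ∈ A p, -g ∈ B p)
    {γ : ℕ → ℝ} (hγ : ∀ k, γ k ∈ Set.Icc (0 : ℝ) 1)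
    (hγsum : Tendsto (fun m => ∑ k ∈ Finset.range m, γ k * (1 - γ k)) atTop atTop)
    {z u v : ℕ → ι → ℝ} (hu : ∀ k, Φ *ᵥ (z k - u k) ∈ A (u k))
    (hv : ∀ k, Φ *ᵥ ((2 : ℝ) • u k - z k - v k) ∈ B (v k))
    (hz : ∀ k, z (k + 1) = z k + (2 * γ k) • (v k - u k)) :
    ∃ p, (∃ g ∈ A p, -g ∈ B p) ∧ Tendsto u atTop (𝓝 p) := by
  classical
  obtain ⟨e, he⟩ := exists_equiv_euclideanSpace_of_posDef hΦ
  have mem_metricOp : ∀ {C : (ι → ℝ) → Set (ι → ℝ)} {z u : ι → ℝ},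
      Φ *ᵥ (z - u) ∈ C u → e z - e u ∈ metricOp Φ e C (e u) := fun h => by
    simpa [metricOp] using h
  choose a ha using fun x => hA' (e.symm x)
  choose b hb using fun x => hB' (e.symm x)
  have hJA : IsResolvent (metricOp Φ e A) fun x => e (a x) := fun x => by
    simpa using mem_metricOp (ha x)
  have hJB : IsResolvent (metricOp Φ e B) fun x => e (b x) := fun x => by
    simpa using mem_metricOp (hb x)
  have hu' : ∀ k, e (u k) = e (a (e (z k))) := fun k =>
    (hA.metricOp he).eq_resolvent hJA (mem_metricOp (hu k))
  have hv' : ∀ k, e (v k) = e (b (reflected (fun x => e (a x)) (e (z k)))) := fun k =>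
    (hB.metricOp he).eq_resolvent hJB (by
      have := mem_metricOp (hv k)
      rwa [map_sub e _ (z k), map_smul, hu' k] at this)
  obtain ⟨p₀, g₀, hgA, hgB⟩ := hzero
  have hinv : Φ *ᵥ (Φ⁻¹ *ᵥ g₀) = g₀ := by
    rw [Matrix.mulVec_mulVec, Matrix.mul_nonsing_inv _ (hΦ.isUnit.map Matrix.detMonoidHom),
      Matrix.one_mulVec]
  obtain ⟨p, ⟨g, hg, hg'⟩, hlim⟩ := tendsto_peacemanRachford (hA.metricOp he) (hB.metricOp he)
    hJA hJB ⟨e p₀, e (Φ⁻¹ *ᵥ g₀), by simpa [metricOp, hinv] using hgA,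
      by simpa [metricOp, Matrix.mulVec_neg, hinv] using hgB⟩ hγ hγsum (z := fun k => e (z k))
    fun k => by rw [hz k, map_add, map_smul, map_sub, ← hu' k, ← hv' k]
  refine ⟨e.symm p, ⟨Φ *ᵥ e.symm g, hg, by simpa [metricOp, Matrix.mulVec_neg] using hg'⟩, ?_⟩
  simpa only [← hu', Function.comp_def, e.symm_apply_apply] using
    (e.symm.continuous.tendsto p).comp hlim

/-- The set-valued operator `∂f + M`. -/
def subdiffAdd (f : (ι → ℝ) → EReal) (M : Matrix ι ι ℝ) (z : ι → ℝ) : Set (ι → ℝ) :=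
  {u | ∃ g ∈ subdiff f z, u = g + M *ᵥ z}

theorem mem_subdiffAdd {f : (ι → ℝ) → EReal} {M : Matrix ι ι ℝ} {z u : ι → ℝ} :
    u ∈ subdiffAdd f M z ↔ u - M *ᵥ z ∈ subdiff f z :=
  ⟨fun ⟨g, hg, h⟩ => by rwa [h, add_sub_cancel_right],
    fun h => ⟨_, h, (sub_add_cancel u _).symm⟩⟩

theorem dotProduct_mulVec_self_of_skew {M : Matrix ι ι ℝ} (hM : Mᵀ = -M) (u : ι → ℝ) :
    u ⬝ᵥ M *ᵥ u = 0 := by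
  have h : u ⬝ᵥ M *ᵥ u = -(u ⬝ᵥ M *ᵥ u) := by
    conv_lhs => rw [Matrix.dotProduct_mulVec, ← Matrix.mulVec_transpose, hM, Matrix.neg_mulVec,
      neg_dotProduct, dotProduct_comm]
  linarith

theorem isMonotoneOp_subdiffAdd {f : (ι → ℝ) → EReal} (hf : ∀ z, f z ≠ ⊥) (hf' : ∃ z, f z ≠ ⊤)
    {M : Matrix ι ι ℝ} (hM : Mᵀ = -M) :
    IsMonotoneOp (dotProductBilin ℝ ℝ) (subdiffAdd f M) := fun u g v h hg hh => by
  have := subdiff_monotone hf hf' (mem_subdiffAdd.1 hg) (mem_subdiffAdd.1 hh)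
  rwa [sub_sub_sub_comm, ← Matrix.mulVec_sub, dotProduct_sub,
    dotProduct_mulVec_self_of_skew hM, sub_zero] at this

end Splitting

namespace Network

variable {N l : ℕ} {n : Fin N → ℕ} {P : Network N l n}

/-! ### Components of states -/

theorem dotProduct_eq_parts (u v : P.State) :
    u ⬝ᵥ v = (∑ i, xPart u i ⬝ᵥ xPart v i) + (∑ i, sigPart u i ⬝ᵥ sigPart v i) +
      (∑ e, lamPart u e ⬝ᵥ lamPart v e) + (∑ i, yPart u i ⬝ᵥ yPart v i) +
      (∑ e, muPart u e ⬝ᵥ muPart v e) + ∑ e, yEdgePart u e ⬝ᵥ yEdgePart v e := by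
  simp only [dotProduct, Fintype.sum_sum_type, Fintype.sum_sigma, Fintype.sum_prod_type, xPart,
    sigPart, lamPart, yPart, muPart, yEdgePart]
  ring

theorem state_ext {u v : P.State} (hx : ∀ i, xPart u i = xPart v i)
    (hs : ∀ i, sigPart u i = sigPart v i) (hl : ∀ e, lamPart u e = lamPart v e)
    (hy : ∀ i, yPart u i = yPart v i) (hm : ∀ e, muPart u e = muPart v e)
    (hye : ∀ e, yEdgePart u e = yEdgePart v e) : u = v := by
  funext q
  rcases q with (⟨i, a⟩ | ⟨i, a⟩) | ⟨e, a⟩ | ⟨i | e | e, a⟩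
  · exact congrFun (hx i) a
  · exact congrFun (hs i) a
  · exact congrFun (hl e) a
  · exact congrFun (hy i) a
  · exact congrFun (hm e) a
  · exact congrFun (hye e) a

/-- The state with given parts. -/
def mkState (x : (i : Fin N) → Fin (n i) → ℝ) (s : Fin N → Fin l → ℝ) (lam : P.Edge → Fin l → ℝ)
    (y : Fin N → Fin l → ℝ) (mu ye : P.Edge → Fin l → ℝ) : P.State :=
  Sum.elim (Sum.elim (fun q => x q.1 q.2) fun q => s q.1 q.2)
    (Sum.elim (fun q => lam q.1 q.2) fun q =>
      Sum.elim (fun i => y i q.2) (Sum.elim (fun e => mu e q.2) fun e => ye e q.2) q.1)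

section mkState

variable (x : (i : Fin N) → Fin (n i) → ℝ) (s : Fin N → Fin l → ℝ) (lam : P.Edge → Fin l → ℝ)
  (y : Fin N → Fin l → ℝ) (mu ye : P.Edge → Fin l → ℝ)

@[simp] theorem xPart_mkState : xPart (mkState x s lam y mu ye) = x := rfl
@[simp] theorem sigPart_mkState : sigPart (mkState x s lam y mu ye) = s := rfl
@[simp] theorem lamPart_mkState : lamPart (mkState x s lam y mu ye) = lam := rfl
@[simp] theorem yPart_mkState : yPart (mkState x s lam y mu ye) = y := rfl
@[simp] theorem muPart_mkState : muPart (mkState x s lam y mu ye) = mu := rfl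
@[simp] theorem yEdgePart_mkState : yEdgePart (mkState x s lam y mu ye) = ye := rfl

end mkState

section Linear

variable (u v : P.State) (t : ℝ) (i : Fin N) (e : P.Edge)

@[simp] theorem xPart_add : xPart (u + v) i = xPart u i + xPart v i := rfl
@[simp] theorem xPart_sub : xPart (u - v) i = xPart u i - xPart v i := rfl
@[simp] theorem xPart_smul : xPart (t • u) i = t • xPart u i := rfl
@[simp] theorem sigPart_add : sigPart (u + v) i = sigPart u i + sigPart v i := rfl
@[simp] theorem sigPart_sub : sigPart (u - v) i = sigPart u i - sigPart v i := rfl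
@[simp] theorem sigPart_smul : sigPart (t • u) i = t • sigPart u i := rfl
@[simp] theorem lamPart_add : lamPart (u + v) e = lamPart u e + lamPart v e := rfl
@[simp] theorem lamPart_sub : lamPart (u - v) e = lamPart u e - lamPart v e := rfl
@[simp] theorem lamPart_smul : lamPart (t • u) e = t • lamPart u e := rfl
@[simp] theorem yPart_add : yPart (u + v) i = yPart u i + yPart v i := rfl
@[simp] theorem yPart_sub : yPart (u - v) i = yPart u i - yPart v i := rfl
@[simp] theorem yPart_smul : yPart (t • u) i = t • yPart u i := rfl
@[simp] theorem muPart_add : muPart (u + v) e = muPart u e + muPart v e := rfl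
@[simp] theorem muPart_sub : muPart (u - v) e = muPart u e - muPart v e := rfl
@[simp] theorem muPart_smul : muPart (t • u) e = t • muPart u e := rfl
@[simp] theorem yEdgePart_add : yEdgePart (u + v) e = yEdgePart u e + yEdgePart v e := rfl
@[simp] theorem yEdgePart_sub : yEdgePart (u - v) e = yEdgePart u e - yEdgePart v e := rfl
@[simp] theorem yEdgePart_smul : yEdgePart (t • u) e = t • yEdgePart u e := rfl

theorem lamB_apply (a : Fin l) : lamB u i a =
    ∑ e : P.Edge, ((if e.1.2 = i then 1 else 0) - (if e.1.1 = i then 1 else 0)) *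
      lamPart u e a := by
  simp only [lamB, Pi.sub_apply, Finset.sum_apply, ite_apply, Pi.zero_apply, sub_mul, ite_mul,
    one_mul, zero_mul, Finset.sum_sub_distrib]

theorem lamB_sub : lamB (u - v) i = lamB u i - lamB v i := by
  ext a
  simp [lamB_apply, mul_sub, Finset.sum_sub_distrib]

theorem disagreement_sub : disagreement (u - v) e = disagreement u e - disagreement v e := by
  simp only [disagreement, xPart_sub, sigPart_sub, Matrix.mulVec_sub]
  abel

end Linear

theorem Bl_mulVec (w : P.Edge × Fin l → ℝ) (i : Fin N) (a : Fin l) :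
    (P.Bl *ᵥ w) (i, a) =
      ∑ e : P.Edge, ((if e.1.2 = i then 1 else 0) - (if e.1.1 = i then 1 else 0)) * w (e, a) := by
  simp [Bl, Matrix.mulVec, dotProduct, Fintype.sum_prod_type, incidence, Matrix.one_apply]

theorem Bl_transpose_mulVec (w : Fin N × Fin l → ℝ) (e : P.Edge) (a : Fin l) :
    (P.Blᵀ *ᵥ w) (e, a) = w (e.1.2, a) - w (e.1.1, a) := by
  simp [Bl, Matrix.mulVec, dotProduct, Fintype.sum_prod_type, incidence, Matrix.one_apply,
    sub_mul, Finset.sum_sub_distrib]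

theorem bigA_mulVec (w : (Σ i : Fin N, Fin (n i)) → ℝ) (i : Fin N) (a : Fin l) :
    (P.bigA *ᵥ w) (i, a) = (P.A i *ᵥ fun b => w ⟨i, b⟩) a := by
  simp only [Matrix.mulVec, dotProduct, Fintype.sum_sigma, bigA, Matrix.of_apply, ite_mul,
    zero_mul]
  rw [Finset.sum_eq_single i]
  · simp
  · intro j _ hj
    simp [hj.symm]
  · simp

theorem bigA_transpose_mulVec (w : Fin N × Fin l → ℝ) (i : Fin N) (b : Fin (n i)) :
    (P.bigAᵀ *ᵥ w) ⟨i, b⟩ = ((P.A i)ᵀ *ᵥ fun a => w (i, a)) b := by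
  simp only [Matrix.mulVec, dotProduct, Fintype.sum_prod_type, bigA, Matrix.of_apply,
    Matrix.transpose_apply, ite_mul, zero_mul]
  rw [Finset.sum_eq_single i]
  · simp
  · intro j _ hj
    simp [hj]
  · simp

variable (P) in
/-- The part of `linT` that couples `x` and `σ` with `λ`. -/
def couplingMatrix : Matrix P.Idx P.Idx ℝ :=
  Matrix.fromBlocks
    0 (Matrix.fromBlocks (P.bigAᵀ * P.Bl) 0 P.Bl 0)
    (Matrix.fromBlocks (-(P.Blᵀ * P.bigA)) (-P.Blᵀ) 0 0) 0

variable (P) in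
/-- The part of `linT` that acts on `ω`. -/
def consensusMatrix : Matrix P.Idx P.Idx ℝ :=
  Matrix.fromBlocks 0 0 0
    (Matrix.fromBlocks 0 0 0 (P.My ⊗ₖ (1 : Matrix (Fin l) (Fin l) ℝ)))

theorem linT_eq : P.linT = P.couplingMatrix + P.consensusMatrix := by
  simp [linT, couplingMatrix, consensusMatrix, Matrix.fromBlocks_add]

theorem couplingMatrix_transpose : P.couplingMatrixᵀ = -P.couplingMatrix := by
  simp [couplingMatrix, Matrix.fromBlocks_transpose, Matrix.fromBlocks_neg, Matrix.transpose_mul]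

theorem My_transpose : P.Myᵀ = -P.My := by
  ext r s
  rcases r with i | e | e <;> rcases s with j | f | f <;>
    simp [My, Matrix.of_apply, eq_comm, apply_ite]

theorem consensusMatrix_transpose : P.consensusMatrixᵀ = -P.consensusMatrix := by
  have : P.Myᵀ ⊗ₖ (1 : Matrix (Fin l) (Fin l) ℝ) = -(P.My ⊗ₖ 1) := by
    rw [My_transpose, ← neg_one_smul ℝ P.My, Matrix.smul_kronecker, neg_one_smul]
  simp [consensusMatrix, Matrix.fromBlocks_transpose, Matrix.fromBlocks_neg,
    ← Matrix.kroneckerMap_transpose, this]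

section couplingMatrix

variable (u : P.State) (i : Fin N) (e : P.Edge)

@[simp]
theorem xPart_couplingMatrix : xPart (P.couplingMatrix *ᵥ u) i = (P.A i)ᵀ *ᵥ lamB u i := by
  ext b
  simp only [xPart, couplingMatrix, Matrix.fromBlocks_mulVec, Sum.elim_inl, Matrix.zero_mulVec,
    zero_add, add_zero, ← Matrix.mulVec_mulVec, bigA_transpose_mulVec, Bl_mulVec]
  congr 2
  ext a
  rw [lamB_apply]
  rfl

@[simp]
theorem sigPart_couplingMatrix : sigPart (P.couplingMatrix *ᵥ u) i = lamB u i := by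
  ext a
  simp only [sigPart, couplingMatrix, Matrix.fromBlocks_mulVec, Sum.elim_inl, Sum.elim_inr,
    Matrix.zero_mulVec, zero_add, add_zero, Bl_mulVec, lamB_apply]
  rfl

@[simp]
theorem lamPart_couplingMatrix : lamPart (P.couplingMatrix *ᵥ u) e = -disagreement u e := by
  ext a
  simp only [lamPart, couplingMatrix, Matrix.fromBlocks_mulVec, Sum.elim_inl, Sum.elim_inr,
    Matrix.zero_mulVec, add_zero, Matrix.neg_mulVec, ← Matrix.mulVec_mulVec, Pi.add_apply,
    Pi.neg_apply, Bl_transpose_mulVec, bigA_mulVec, disagreement, Pi.sub_apply]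
  change -((P.A e.1.2 *ᵥ xPart u e.1.2) a - (P.A e.1.1 *ᵥ xPart u e.1.1) a) +
    -(sigPart u e.1.2 a - sigPart u e.1.1 a) = _
  ring

@[simp]
theorem yPart_couplingMatrix : yPart (P.couplingMatrix *ᵥ u) i = 0 := by
  ext a
  simp [yPart, couplingMatrix, Matrix.fromBlocks_mulVec]

@[simp]
theorem muPart_couplingMatrix : muPart (P.couplingMatrix *ᵥ u) e = 0 := by
  ext a
  simp [muPart, couplingMatrix, Matrix.fromBlocks_mulVec]

@[simp]
theorem yEdgePart_couplingMatrix : yEdgePart (P.couplingMatrix *ᵥ u) e = 0 := by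
  ext a
  simp [yEdgePart, couplingMatrix, Matrix.fromBlocks_mulVec]

@[simp]
theorem xPart_consensusMatrix : xPart (P.consensusMatrix *ᵥ u) i = 0 := by
  ext a
  simp [xPart, consensusMatrix, Matrix.fromBlocks_mulVec]

@[simp]
theorem sigPart_consensusMatrix : sigPart (P.consensusMatrix *ᵥ u) i = 0 := by
  ext a
  simp [sigPart, consensusMatrix, Matrix.fromBlocks_mulVec]

@[simp]
theorem lamPart_consensusMatrix : lamPart (P.consensusMatrix *ᵥ u) e = 0 := by
  ext a
  simp [lamPart, consensusMatrix, Matrix.fromBlocks_mulVec]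

@[simp]
theorem yPart_consensusMatrix :
    yPart (P.consensusMatrix *ᵥ u) i = -∑ f : P.Edge, if f.1.1 = i then muPart u f else 0 := by
  ext a
  have neg_ite (p : Prop) [Decidable p] (r : ℝ) :
      (if p then -r else 0) = -(if p then r else 0) := by split_ifs <;> simp
  simp [yPart, consensusMatrix, Matrix.mulVec, dotProduct, Fintype.sum_prod_type,
    Fintype.sum_sum_type, My, Matrix.one_apply, muPart, ite_apply, neg_ite]

@[simp]
theorem muPart_consensusMatrix :
    muPart (P.consensusMatrix *ᵥ u) e = yPart u e.1.1 - yEdgePart u e := by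
  ext a
  simp [yPart, consensusMatrix, Matrix.mulVec, dotProduct,
    Fintype.sum_prod_type, Fintype.sum_sum_type, My, Matrix.one_apply,
    muPart, yEdgePart, sub_eq_add_neg]

@[simp]
theorem yEdgePart_consensusMatrix : yEdgePart (P.consensusMatrix *ᵥ u) e = muPart u e := by
  ext a
  simp [consensusMatrix, Matrix.mulVec, dotProduct,
    Fintype.sum_prod_type, Fintype.sum_sum_type, My, Matrix.one_apply,
    muPart, yEdgePart]

end couplingMatrix

section designMatrix

variable (τ : P.StepSizes) (u : P.State) (i : Fin N) (e : P.Edge)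

@[simp]
theorem xPart_designMatrix : xPart (designMatrix τ *ᵥ u) i =
    (τ.t1 i)⁻¹ • xPart u i - (1 / 2 : ℝ) • ((P.A i)ᵀ *ᵥ lamB u i) := by
  rw [← xPart_couplingMatrix]
  ext b
  simp only [xPart, couplingMatrix, designMatrix, Matrix.fromBlocks_mulVec, Sum.elim_inl,
    Matrix.zero_mulVec, zero_add, add_zero, Matrix.neg_mulVec, Matrix.smul_mulVec, Pi.add_apply,
    Matrix.mulVec_diagonal, Pi.neg_apply, Pi.smul_apply, Pi.sub_apply, smul_eq_mul,
    ← sub_eq_add_neg]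
  rfl

@[simp]
theorem sigPart_designMatrix : sigPart (designMatrix τ *ᵥ u) i =
    (τ.t2 i)⁻¹ • sigPart u i - (1 / 2 : ℝ) • lamB u i := by
  rw [← sigPart_couplingMatrix]
  ext b
  simp only [sigPart, couplingMatrix, designMatrix, Matrix.fromBlocks_mulVec, Sum.elim_inl,
    Sum.elim_inr, Matrix.zero_mulVec, zero_add, add_zero, Matrix.neg_mulVec, Matrix.smul_mulVec,
    Pi.add_apply, Matrix.mulVec_diagonal, Pi.neg_apply, Pi.smul_apply, Pi.sub_apply, smul_eq_mul,
    ← sub_eq_add_neg]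
  rfl

@[simp]
theorem lamPart_designMatrix : lamPart (designMatrix τ *ᵥ u) e =
    (τ.t3 e)⁻¹ • lamPart u e - (1 / 2 : ℝ) • disagreement u e := by
  rw [← neg_neg (disagreement u e), ← lamPart_couplingMatrix]
  ext b
  simp only [lamPart, couplingMatrix, designMatrix, Matrix.fromBlocks_mulVec, Sum.elim_inl,
    Sum.elim_inr, Matrix.zero_mulVec, zero_add, add_zero, Matrix.neg_mulVec, Matrix.smul_mulVec,
    Pi.add_apply, Matrix.mulVec_diagonal, Pi.neg_apply, Pi.smul_apply, Pi.sub_apply, smul_eq_mul,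
    Function.comp_apply]
  ring

@[simp]
theorem yPart_designMatrix : yPart (designMatrix τ *ᵥ u) i = (τ.t4 i)⁻¹ • yPart u i := by
  ext a
  simp [yPart, designMatrix, Matrix.fromBlocks_mulVec, Matrix.mulVec_diagonal, omegaOwner]

@[simp]
theorem muPart_designMatrix : muPart (designMatrix τ *ᵥ u) e = (τ.t4 e.1.1)⁻¹ • muPart u e := by
  ext a
  simp [muPart, designMatrix, Matrix.fromBlocks_mulVec, Matrix.mulVec_diagonal, omegaOwner]

@[simp]
theorem yEdgePart_designMatrix :
    yEdgePart (designMatrix τ *ᵥ u) e = (τ.t4 e.1.1)⁻¹ • yEdgePart u e := by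
  ext a
  simp [yEdgePart, designMatrix, Matrix.fromBlocks_mulVec, Matrix.mulVec_diagonal, omegaOwner]

end designMatrix

/-! ### The splitting -/

variable (P) in
/-- The sum of the objectives as a function of the state. -/
def objective (ψ : P.State) : EReal := ∑ i, P.J i (xPart ψ i, sigPart ψ i)

variable (P) in
/-- The states that satisfy all local constraints. -/
def localStates : Set P.State := {ψ | ∀ i, localPart ψ i ∈ P.localFeasB i}

variable (P) in
/-- The operator of the splitting `T = opA + opB` that is resolved by the consensus subroutine and
the first local problems. -/
def opA : P.State → Set P.State :=
  subdiffAdd P.objective ((1 / 2 : ℝ) • P.couplingMatrix + P.consensusMatrix)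

variable (P) in
/-- The operator of the splitting `T = opA + opB` that is resolved by the second local problems. -/
def opB : P.State → Set P.State :=
  subdiffAdd (iota P.localStates) ((1 / 2 : ℝ) • P.couplingMatrix)

theorem localPart_mem_localFeasB {ψ : P.State} {i : Fin N} :
    localPart ψ i ∈ P.localFeasB i ↔
      (xPart ψ i ∈ P.X i ∧ (xPart ψ i, sigPart ψ i) ∈ P.setQ i) ∧ localPart ψ i ∈ P.setF i := by
  rw [and_assoc, and_comm (a := _ ∈ P.setQ i)]
  rfl

theorem convexPart_eq : P.convexPart = P.objective + iota P.localStates := by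
  funext ψ
  have hi (i : Fin N) : P.J i (xPart ψ i, sigPart ψ i) + iota (P.X i) (xPart ψ i) +
      iota (P.setQ i) (xPart ψ i, sigPart ψ i) + iota (P.setF i) (localPart ψ i) =
      P.J i (xPart ψ i, sigPart ψ i) + iota (P.localFeasB i) (localPart ψ i) := by
    rw [add_assoc, add_assoc, ← add_assoc (iota _ _), iota_add_iota, iota_add_iota]
    exact congrArg _ (iota_congr localPart_mem_localFeasB.symm)
  have hS : ψ ∈ P.localStates ↔ (localPart ψ) ∈ Set.univ.pi P.localFeasB := by
    simp [localStates]
  simp only [convexPart, hi, Finset.sum_add_distrib, sum_iota]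
  exact congrArg _ (iota_congr hS.symm)

theorem objective_ne_bot (hJ : ∀ i, IsCCP (P.J i)) (ψ : P.State) : P.objective ψ ≠ ⊥ :=
  sum_ne_bot fun i _ => (hJ i).ne_bot _

theorem exists_objective_ne_top (hJ : ∀ i, IsCCP (P.J i)) : ∃ ψ : P.State, P.objective ψ ≠ ⊤ := by
  choose z hz using fun i => (hJ i).proper
  refine ⟨mkState (fun i => (z i).1) (fun i => (z i).2) 0 0 0 0, ?_⟩
  have hr (i : Fin N) : P.J i (z i) = ((P.J i (z i)).toReal : EReal) :=
    (EReal.coe_toReal (hz i) ((hJ i).ne_bot _)).symm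
  change ∑ i, P.J i (z i) ≠ ⊤
  rw [Finset.sum_congr rfl fun i _ => hr i, ← coe_sum_real]
  exact EReal.coe_ne_top _

theorem isMonotoneOp_opA (hJ : ∀ i, IsCCP (P.J i)) :
    IsMonotoneOp (dotProductBilin ℝ ℝ) P.opA :=
  isMonotoneOp_subdiffAdd (objective_ne_bot hJ) (exists_objective_ne_top hJ) (by
    rw [Matrix.transpose_add, Matrix.transpose_smul, couplingMatrix_transpose,
      consensusMatrix_transpose, smul_neg, neg_add])

theorem isMonotoneOp_opB (hne : P.localStates.Nonempty) :
    IsMonotoneOp (dotProductBilin ℝ ℝ) P.opB :=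
  isMonotoneOp_subdiffAdd (iota_ne_bot _) (hne.imp fun ψ hψ => by simp [iota_of_mem hψ])
    (by rw [Matrix.transpose_smul, couplingMatrix_transpose, smul_neg])

theorem mem_zer_opT_of_mem {ψ g : P.State} (hA : g ∈ P.opA ψ) (hB : -g ∈ P.opB ψ) :
    ψ ∈ zer P.opT := by
  have hsum := add_mem_subdiff (mem_subdiffAdd.1 hA) (mem_subdiffAdd.1 hB)
  rw [← convexPart_eq] at hsum
  refine ⟨_, hsum, ?_⟩
  rw [linT_eq, Matrix.add_mulVec, Matrix.add_mulVec, Matrix.smul_mulVec]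
  module

/-! ### Residuals of the two resolvents -/

/-- The common part of the inclusions `Φ (a - b) ∈ opA b` and `Φ (a - b) ∈ opB b`: what is left of
`Φ (a - b)` when the coupling of both operators has been subtracted. -/
def residual (τ : P.StepSizes) (a b : P.State) : P.State :=
  designMatrix τ *ᵥ (a - b) - (1 / 2 : ℝ) • (P.couplingMatrix *ᵥ b)

section residual

variable (τ : P.StepSizes) (a b : P.State) (i : Fin N) (e : P.Edge)

@[simp]
theorem xPart_residual : xPart (residual τ a b) i =
    (τ.t1 i)⁻¹ • (xPart a i - xPart b i) - (1 / 2 : ℝ) • ((P.A i)ᵀ *ᵥ lamB a i) := by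
  simp only [residual, xPart_sub, xPart_smul, xPart_designMatrix, xPart_couplingMatrix,
    Matrix.mulVec_sub]
  module

@[simp]
theorem sigPart_residual : sigPart (residual τ a b) i =
    (τ.t2 i)⁻¹ • (sigPart a i - sigPart b i) - (1 / 2 : ℝ) • lamB a i := by
  simp only [residual, sigPart_sub, sigPart_smul, sigPart_designMatrix, sigPart_couplingMatrix,
    lamB_sub]
  module

theorem lamPart_residual : lamPart (residual τ a b) e =
    (τ.t3 e)⁻¹ • (lamPart a e + τ.t3 e • (disagreement b e - (1 / 2 : ℝ) • disagreement a e) -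
      lamPart b e) := by
  have ht : (τ.t3 e)⁻¹ * τ.t3 e = 1 := inv_mul_cancel₀ (τ.t3_pos e).ne'
  simp only [residual, lamPart_sub, lamPart_smul, lamPart_designMatrix, lamPart_couplingMatrix,
    disagreement_sub, smul_sub, smul_add, smul_smul, ht, ← mul_assoc, one_smul, one_mul]
  module

@[simp]
theorem yPart_residual : yPart (residual τ a b) i = (τ.t4 i)⁻¹ • (yPart a i - yPart b i) := by
  simp [residual]

@[simp]
theorem muPart_residual :
    muPart (residual τ a b) e = (τ.t4 e.1.1)⁻¹ • (muPart a e - muPart b e) := by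
  simp [residual]

@[simp]
theorem yEdgePart_residual :
    yEdgePart (residual τ a b) e = (τ.t4 e.1.1)⁻¹ • (yEdgePart a e - yEdgePart b e) := by
  simp [residual]

end residual

/-! ### The first resolvent -/

/-- The updates of an iteration that produce `ψ` from `ψt`. -/
structure FirstStep (τ : P.StepSizes) (ψt ψ : P.State) : Prop where
  acu : AuxConsensusUpdate τ ψt ψ
  argminA : ∀ i, IsMinOn (localObjA τ ψt i) Set.univ (xPart ψ i, sigPart ψ i)
  lam : ∀ e : P.Edge, lamPart ψ e =
    lamPart ψt e + ((1 / 2) * τ.t3 e) • disagreement ((2 : ℝ) • ψ - ψt) e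

/-- The finite part of `localObjA`, without the objective `J_i`. -/
def localPenaltyA (τ : P.StepSizes) (ψt : P.State) (i : Fin N)
    (z : (Fin (n i) → ℝ) × (Fin l → ℝ)) : ℝ :=
  (1 / 2) * (lamB ψt i ⬝ᵥ (P.A i *ᵥ z.1 + z.2)) +
    1 / (2 * τ.t1 i) * sqNorm (z.1 - xPart ψt i) + 1 / (2 * τ.t2 i) * sqNorm (z.2 - sigPart ψt i)

theorem half_div_mul_sqNorm_add {ι : Type*} [Fintype ι] (t : ℝ) (z v d : ι → ℝ) :
    1 / (2 * t) * sqNorm (z + d - v) = 1 / (2 * t) * sqNorm (z - v) +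
      -((t⁻¹ • (v - z)) ⬝ᵥ d) + 1 / (2 * t) * sqNorm d := by
  rw [add_sub_right_comm, sqNorm_add, ← neg_sub v z, neg_dotProduct, smul_dotProduct, smul_eq_mul,
    one_div, mul_inv]
  ring

theorem hasQuadraticExpansion_localPenaltyA (τ : P.StepSizes) (ψt ψ : P.State) (i : Fin N) :
    HasQuadraticExpansion (localPenaltyA τ ψt i) (xPart ψ i, sigPart ψ i)
      (-(dotProductBilin ℝ ℝ (xPart (residual τ ψt ψ) i)).coprod
        (dotProductBilin ℝ ℝ (sigPart (residual τ ψt ψ) i)))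
      (QuadraticMap.prod ((1 / (2 * τ.t1 i)) • sqForm _) ((1 / (2 * τ.t2 i)) • sqForm _)) := by
  intro d
  simp only [localPenaltyA, Prod.fst_add, Prod.snd_add, half_div_mul_sqNorm_add, Matrix.mulVec_add,
    dotProduct_add, xPart_residual, sigPart_residual, LinearMap.neg_apply, LinearMap.coprod_apply,
    dotProductBilin_apply_apply, sub_dotProduct, smul_dotProduct, Matrix.dotProduct_mulVec,
    Matrix.mulVec_transpose, QuadraticMap.prod_apply, smul_apply, sqForm_apply,
    smul_eq_mul]
  ring

theorem posDef_half_div_smul_sqForm {t : ℝ} (ht : 0 < t) (ι : Type*) [Fintype ι] :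
    ((1 / (2 * t)) • sqForm ι).PosDef :=
  (posDef_sqForm ι).smul (by positivity)

theorem exists_isMinOn_localObjA {i : Fin N} (hJ : IsCCP (P.J i)) (τ : P.StepSizes)
    (ψt : P.State) : ∃ z, IsMinOn (localObjA τ ψt i) Set.univ z :=
  hJ.exists_isMinOn_add (hasQuadraticExpansion_localPenaltyA τ ψt ψt i)
    ((posDef_half_div_smul_sqForm (τ.t1_pos i) _).prod
      (posDef_half_div_smul_sqForm (τ.t2_pos i) _))

theorem exists_firstStep (hJ : ∀ i, IsCCP (P.J i)) (τ : P.StepSizes) (ψt : P.State) :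
    ∃ ψ, FirstStep τ ψt ψ := by
  choose z hz using fun i => exists_isMinOn_localObjA (hJ i) τ ψt
  let y : Fin N → Fin l → ℝ := fun i =>
    ((1 + τ.t4 i ^ 2) /
        (1 + τ.t4 i ^ 2 * (1 + ((Finset.univ.filter fun e : P.Edge => e.1.1 = i).card : ℝ)))) •
      (yPart ψt i + (τ.t4 i / (1 + τ.t4 i ^ 2)) •
        ∑ e : P.Edge, if e.1.1 = i then muPart ψt e + τ.t4 i • yEdgePart ψt e else 0)
  let mu : P.Edge → Fin l → ℝ := fun e => (1 / (1 + τ.t4 e.1.1 ^ 2)) • muPart ψt e +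
      (τ.t4 e.1.1 / (1 + τ.t4 e.1.1 ^ 2)) • (yEdgePart ψt e - y e.1.1)
  let ye : P.Edge → Fin l → ℝ := fun e => yEdgePart ψt e - τ.t4 e.1.1 • mu e
  let withLam (lam : P.Edge → Fin l → ℝ) : P.State :=
    mkState (fun i => (z i).1) (fun i => (z i).2) lam y mu ye
  exact ⟨withLam fun e => lamPart ψt e +
      ((1 / 2) * τ.t3 e) • disagreement ((2 : ℝ) • withLam 0 - ψt) e,
    ⟨fun _ => rfl, fun _ => rfl, fun _ => rfl⟩, hz, fun _ => rfl⟩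

namespace AuxConsensusUpdate

variable {τ : P.StepSizes} {ψt ψ : P.State}

theorem sum_muPart_apply (h : AuxConsensusUpdate τ ψt ψ) (i : Fin N) (a : Fin l) :
    ∑ e : P.Edge, (if e.1.1 = i then muPart ψ e a else 0) =
      1 / (1 + τ.t4 i ^ 2) *
        ∑ e : P.Edge, (if e.1.1 = i then muPart ψt e a + τ.t4 i * yEdgePart ψt e a else 0) -
      τ.t4 i / (1 + τ.t4 i ^ 2) *
        (((Finset.univ.filter fun e : P.Edge => e.1.1 = i).card : ℝ) * yPart ψ i a) := by
  rw [Finset.card_filter, Nat.cast_sum, Finset.sum_mul, Finset.mul_sum, Finset.mul_sum,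
    ← Finset.sum_sub_distrib]
  refine Finset.sum_congr rfl fun e _ => ?_
  split_ifs with he
  · subst he
    rw [h.mu e]
    simp only [Pi.add_apply, Pi.smul_apply, Pi.sub_apply, smul_eq_mul, Nat.cast_one]
    ring
  · simp

theorem y_eq (h : AuxConsensusUpdate τ ψt ψ) (i : Fin N) :
    (τ.t4 i)⁻¹ • (yPart ψt i - yPart ψ i) =
      -∑ e : P.Edge, if e.1.1 = i then muPart ψ e else 0 := by
  ext a
  have ht := τ.t4_pos i
  have hy := congrFun (h.y i) a
  have hmu := h.sum_muPart_apply i a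
  simp only [Pi.add_apply, Pi.smul_apply, smul_eq_mul, Finset.sum_apply, ite_apply,
    Pi.zero_apply] at hy
  simp only [Pi.neg_apply, Pi.smul_apply, smul_eq_mul, Finset.sum_apply, ite_apply,
    Pi.zero_apply, Pi.sub_apply]
  rw [hmu]
  have hdeg : (0 : ℝ) ≤ (Finset.univ.filter fun e : P.Edge => e.1.1 = i).card := by positivity
  have hden : 1 + τ.t4 i ^ 2 *
      (1 + ((Finset.univ.filter fun e : P.Edge => e.1.1 = i).card : ℝ)) ≠ 0 := by positivity
  field_simp at hy ⊢
  linear_combination -hy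

theorem mu_eq (h : AuxConsensusUpdate τ ψt ψ) (e : P.Edge) :
    (τ.t4 e.1.1)⁻¹ • (muPart ψt e - muPart ψ e) = yPart ψ e.1.1 - yEdgePart ψ e := by
  ext a
  have ht := τ.t4_pos e.1.1
  have hmu := congrFun (h.mu e) a
  have hy := congrFun (h.yEdge e) a
  simp only [Pi.add_apply, Pi.smul_apply, smul_eq_mul, Pi.sub_apply] at hmu hy ⊢
  rw [hy]
  field_simp at hmu ⊢
  linear_combination -hmu

theorem yEdge_eq (h : AuxConsensusUpdate τ ψt ψ) (e : P.Edge) :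
    (τ.t4 e.1.1)⁻¹ • (yEdgePart ψt e - yEdgePart ψ e) = muPart ψ e := by
  rw [h.yEdge e, sub_sub_cancel, smul_smul, inv_mul_cancel₀ (τ.t4_pos _).ne', one_smul]

end AuxConsensusUpdate

theorem mem_subdiff_objective {ψ g : P.State}
    (hloc : ∀ i w, P.J i (xPart ψ i, sigPart ψ i) + ((xPart g i ⬝ᵥ (w.1 - xPart ψ i) +
      sigPart g i ⬝ᵥ (w.2 - sigPart ψ i) : ℝ) : EReal) ≤ P.J i w)
    (hlam : ∀ e, lamPart g e = 0) (hy : ∀ i, yPart g i = 0) (hmu : ∀ e, muPart g e = 0)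
    (hye : ∀ e, yEdgePart g e = 0) : g ∈ subdiff P.objective ψ := fun w => by
  simp only [dotProduct_eq_parts, hlam, hy, hmu, hye, zero_dotProduct, Finset.sum_const_zero,
    add_zero]
  rw [← Finset.sum_add_distrib, objective, coe_sum_real, ← Finset.sum_add_distrib]
  exact Finset.sum_le_sum fun i _ => hloc i (xPart w i, sigPart w i)

theorem FirstStep.lamPart_residual_eq_zero {τ : P.StepSizes} {ψt ψ : P.State}
    (h : FirstStep τ ψt ψ) (e : P.Edge) : lamPart (residual τ ψt ψ) e = 0 := by
  have hdis : disagreement ((2 : ℝ) • ψ - ψt) e =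
      (2 : ℝ) • disagreement ψ e - disagreement ψt e := by
    simp only [disagreement, xPart_sub, xPart_smul, sigPart_sub, sigPart_smul, Matrix.mulVec_sub,
      Matrix.mulVec_smul]
    module
  rw [lamPart_residual, h.lam e, hdis]
  module

theorem FirstStep.mem_opA (hJ : ∀ i, IsCCP (P.J i)) {τ : P.StepSizes} {ψt ψ : P.State}
    (h : FirstStep τ ψt ψ) : designMatrix τ *ᵥ (ψt - ψ) ∈ P.opA ψ := by
  have hg : designMatrix τ *ᵥ (ψt - ψ) -
      ((1 / 2 : ℝ) • P.couplingMatrix + P.consensusMatrix) *ᵥ ψ =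
      residual τ ψt ψ - P.consensusMatrix *ᵥ ψ := by
    rw [residual, Matrix.add_mulVec, Matrix.smul_mulVec, sub_add_eq_sub_sub]
  refine mem_subdiffAdd.2 (hg ▸ mem_subdiff_objective (fun i w => ?_) ?_ ?_ ?_ ?_)
  · simpa only [LinearMap.neg_apply, neg_neg, LinearMap.coprod_apply, dotProductBilin_apply_apply,
      Prod.fst_sub, Prod.snd_sub, xPart_sub, sigPart_sub, xPart_consensusMatrix,
      sigPart_consensusMatrix, sub_zero] using
      (hJ i).sub_le_of_isMinOn_add (hasQuadraticExpansion_localPenaltyA τ ψt ψ i) (h.argminA i) w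
  · simp [h.lamPart_residual_eq_zero]
  · simp [h.acu.y_eq]
  · simp [h.acu.mu_eq]
  · simp [h.acu.yEdge_eq]

/-! ### The second resolvent -/

/-- The updates of an iteration that produce `ψb` from `ψh`. -/
structure SecondStep (τ : P.StepSizes) (ψh ψb : P.State) : Prop where
  feasB : ∀ i, localPart ψb i ∈ P.localFeasB i
  argminB : ∀ i, IsMinOn (localObjB τ ψh i) (P.localFeasB i) (localPart ψb i)
  lamBar : ∀ e : P.Edge, lamPart ψb e =
    lamPart ψh e + τ.t3 e • (disagreement ψb e - (1 / 2 : ℝ) • disagreement ψh e)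
  muBar : ∀ e : P.Edge, muPart ψb e = muPart ψh e

variable (P) in
/-- The difference of the two sides of the equation that defines `F_i`. -/
def consensusDefect (i : Fin N) : P.Local i →ₗ[ℝ] (Fin l → ℝ) :=
  (((N : ℝ) - 1) • (P.A i).mulVecLin).coprod ((-LinearMap.id).coprod
    ((-P.W i i • LinearMap.id).coprod (-∑ e : P.InEdge i, P.W e.1.1.1 i • LinearMap.proj e)))

theorem mem_setF_iff {i : Fin N} {z : P.Local i} : z ∈ P.setF i ↔ P.consensusDefect i z = 0 := by
  have h : P.consensusDefect i z = ((N : ℝ) - 1) • (P.A i *ᵥ z.1) - z.2.1 -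
      (P.W i i • z.2.2.1 + ∑ e : P.InEdge i, P.W e.1.1.1 i • z.2.2.2 e) := by
    simp only [consensusDefect, LinearMap.coprod_apply, LinearMap.smul_apply, LinearMap.neg_apply,
      LinearMap.id_apply, LinearMap.sum_apply, LinearMap.proj_apply, Matrix.mulVecLin_apply]
    module
  rw [h, sub_eq_zero]
  rfl

variable (P) in
/-- The feasible set `localFeasB` with a set `S` in the place of `X_i`. -/
def localConstraint (i : Fin N) (S : Set (Fin (n i) → ℝ)) : Set (P.Local i) :=
  {z | z.1 ∈ S ∧ z ∈ P.setF i ∧ P.A i *ᵥ z.1 + z.2.1 ≤ P.c}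

theorem localConstraint_eq (i : Fin N) (S : Set (Fin (n i) → ℝ)) : P.localConstraint i S =
    LinearMap.fst ℝ _ _ ⁻¹' S ∩ (P.consensusDefect i ⁻¹' {0} ∩
      (((P.A i).mulVecLin.coprod (LinearMap.fst ℝ _ _) : P.Local i →ₗ[ℝ] _) ⁻¹' Set.Iic P.c)) := by
  ext z
  exact and_congr Iff.rfl (and_congr mem_setF_iff Iff.rfl)

theorem convex_localConstraint {i : Fin N} {S : Set (Fin (n i) → ℝ)} (hS : Convex ℝ S) :
    Convex ℝ (P.localConstraint i S) := by
  rw [localConstraint_eq]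
  exact (hS.linear_preimage _).inter (((convex_singleton 0).linear_preimage _).inter
    ((convex_Iic P.c).linear_preimage _))

theorem isClosed_localFeasB {i : Fin N} (hX : IsClosed (P.X i)) : IsClosed (P.localFeasB i) := by
  change IsClosed (P.localConstraint i (P.X i))
  rw [localConstraint_eq]
  exact (hX.preimage continuous_fst).inter
    ((isClosed_singleton.preimage (LinearMap.continuous_of_finiteDimensional _)).inter
      (isClosed_Iic.preimage (LinearMap.continuous_of_finiteDimensional _)))

theorem isCCP_iota_localFeasB (hX : P.FeasibleSetsRegular) {i : Fin N}
    (hne : (P.localFeasB i).Nonempty) : IsCCP (iota (P.localFeasB i)) :=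
  isCCP_iota hne (isClosed_localFeasB (hX.closed i)) (convex_localConstraint (hX.convex i))

/-- The linear functional on the variables of agent `i` with coefficients `g`. -/
def dotLocal {i : Fin N} (g : P.Local i) : P.Local i →ₗ[ℝ] ℝ :=
  (dotProductBilin ℝ ℝ g.1).coprod ((dotProductBilin ℝ ℝ g.2.1).coprod
    ((dotProductBilin ℝ ℝ g.2.2.1).coprod
      (∑ e : P.InEdge i, (dotProductBilin ℝ ℝ (g.2.2.2 e)).comp (LinearMap.proj e))))

theorem sum_inEdge {M : Type*} [AddCommMonoid M] (f : P.Edge → M) :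
    ∑ i, ∑ e : P.InEdge i, f e.1 = ∑ e, f e :=
  Fintype.sum_fiberwise (fun e : P.Edge => e.1.2) f

theorem sum_dotLocal {g : P.State} (hlam : ∀ e, lamPart g e = 0) (hmu : ∀ e, muPart g e = 0)
    (d : P.State) : ∑ i, dotLocal (localPart g i) (localPart d i) = g ⬝ᵥ d := by
  simp only [dotProduct_eq_parts, hlam, hmu, zero_dotProduct, Finset.sum_const_zero, add_zero,
    ← sum_inEdge fun e => yEdgePart g e ⬝ᵥ yEdgePart d e, ← Finset.sum_add_distrib]
  simp [dotLocal, localPart, add_assoc]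

theorem hasQuadraticExpansion_localObjB (τ : P.StepSizes) (ψh ψ : P.State) (i : Fin N) :
    HasQuadraticExpansion (localObjB τ ψh i) (localPart ψ i)
      (-dotLocal (localPart (residual τ ψh ψ) i))
      (((1 / (2 * τ.t1 i)) • sqForm _).prod (((1 / (2 * τ.t2 i)) • sqForm _).prod
        (((1 / (2 * τ.t4 i)) • sqForm _).prod
          (QuadraticMap.pi fun e : P.InEdge i => (1 / (2 * τ.t4 e.1.1.1)) • sqForm _)))) := by
  intro d
  have ht1 := (τ.t1_pos i).ne'
  have ht2 := (τ.t2_pos i).ne'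
  simp only [localObjB, localPart, dotLocal, Prod.fst_add, Prod.snd_add, Pi.add_apply,
    half_div_mul_sqNorm_add, xPart_residual, sigPart_residual, yPart_residual, yEdgePart_residual,
    LinearMap.neg_apply, LinearMap.coprod_apply, LinearMap.sum_apply, LinearMap.comp_apply,
    LinearMap.proj_apply, dotProductBilin_apply_apply, QuadraticMap.prod_apply,
    QuadraticMap.pi_apply, smul_apply, sqForm_apply, Finset.sum_add_distrib,
    Finset.sum_neg_distrib, sub_dotProduct, smul_dotProduct, smul_eq_mul]
  field_simp
  ring

theorem exists_localPart_eq (z : ∀ i, P.Local i) (lam mu : P.Edge → Fin l → ℝ) :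
    ∃ ψ : P.State, (∀ i, localPart ψ i = z i) ∧ lamPart ψ = lam ∧ muPart ψ = mu := by
  refine ⟨mkState (fun i => (z i).1) (fun i => (z i).2.1) lam (fun i => (z i).2.2.1) mu
    (fun e => (z e.1.2).2.2.2 ⟨e, rfl⟩), fun i => ?_, rfl, rfl⟩
  have hz : (fun e : P.InEdge i => (z e.1.1.2).2.2.2 ⟨e.1, rfl⟩) = (z i).2.2.2 := by
    funext ⟨e, he⟩
    subst he
    rfl
  simp only [localPart, xPart_mkState, sigPart_mkState, yPart_mkState, yEdgePart_mkState]
  rw [hz]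

theorem exists_argminB (hX : P.FeasibleSetsRegular) {i : Fin N} (hne : (P.localFeasB i).Nonempty)
    (τ : P.StepSizes) (ψh : P.State) :
    ∃ z ∈ P.localFeasB i, IsMinOn (localObjB τ ψh i) (P.localFeasB i) z := by
  obtain ⟨z, hz⟩ := (isCCP_iota_localFeasB hX hne).exists_isMinOn_add
    (hasQuadraticExpansion_localObjB τ ψh ψh i)
    ((posDef_half_div_smul_sqForm (τ.t1_pos i) _).prod
      ((posDef_half_div_smul_sqForm (τ.t2_pos i) _).prod
        ((posDef_half_div_smul_sqForm (τ.t4_pos i) _).prod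
          (QuadraticMap.posDef_pi_iff.2 fun e => posDef_half_div_smul_sqForm (τ.t4_pos _) _))))
  exact ⟨z, (isMinOn_iota_add_iff hne).1 hz⟩

theorem exists_secondStep (hX : P.FeasibleSetsRegular) (hne : ∀ i, (P.localFeasB i).Nonempty)
    (τ : P.StepSizes) (ψh : P.State) : ∃ ψb, SecondStep τ ψh ψb := by
  choose z hz hmin using fun i => exists_argminB hX (hne i) τ ψh
  obtain ⟨ψ₀, h₀, -⟩ := exists_localPart_eq z 0 0
  obtain ⟨ψ, hψ, hlam, hmu⟩ := exists_localPart_eq z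
    (fun e => lamPart ψh e + τ.t3 e • (disagreement ψ₀ e - (1 / 2 : ℝ) • disagreement ψh e))
    (muPart ψh)
  have hx (i : Fin N) : xPart ψ i = xPart ψ₀ i := congrArg Prod.fst ((hψ i).trans (h₀ i).symm)
  have hs (i : Fin N) : sigPart ψ i = sigPart ψ₀ i :=
    congrArg (fun z => z.2.1) ((hψ i).trans (h₀ i).symm)
  refine ⟨ψ, fun i => hψ i ▸ hz i, fun i => hψ i ▸ hmin i, fun e => ?_, fun e => by rw [hmu]⟩
  simp only [hlam, disagreement, hx, hs]

theorem SecondStep.mem_opB (hX : P.FeasibleSetsRegular) {τ : P.StepSizes} {ψh ψb : P.State}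
    (h : SecondStep τ ψh ψb) : designMatrix τ *ᵥ (ψh - ψb) ∈ P.opB ψb := by
  have hlam (e : P.Edge) : lamPart (residual τ ψh ψb) e = 0 := by
    rw [lamPart_residual, h.lamBar e, sub_self, smul_zero]
  have hmu (e : P.Edge) : muPart (residual τ ψh ψb) e = 0 := by
    rw [muPart_residual, h.muBar, sub_self, smul_zero]
  refine mem_subdiffAdd.2 ?_
  rw [Matrix.smul_mulVec]
  refine (mem_subdiff_iota (S := P.localStates) h.feasB).2 fun w hw => ?_
  rw [← residual, ← sum_dotLocal hlam hmu]
  refine Finset.sum_nonpos fun i _ => ?_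
  have hne : (P.localFeasB i).Nonempty := ⟨_, h.feasB i⟩
  have hle := (isCCP_iota_localFeasB hX hne).sub_le_of_isMinOn_add
    (hasQuadraticExpansion_localObjB τ ψh ψb i)
    ((isMinOn_iota_add_iff hne).2 ⟨h.feasB i, h.argminB i⟩) (localPart w i)
  rw [iota_of_mem (h.feasB i), iota_of_mem (hw i), LinearMap.neg_apply, neg_neg, zero_add] at hle
  exact EReal.coe_le_coe_iff.1 hle

theorem iteration_iff {τ : P.StepSizes} {γ : ℝ} {ψt ψ ψh ψb ψt' : P.State} :
    Iteration τ γ ψt ψ ψh ψb ψt' ↔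
      FirstStep τ ψt ψ ∧ ψh = (2 : ℝ) • ψ - ψt ∧ SecondStep τ ψh ψb ∧
        ψt' = ψt + (2 * γ) • (ψb - ψ) :=
  ⟨fun h => ⟨⟨h.acu, h.argminA, h.reflect ▸ h.lam⟩, h.reflect,
      ⟨h.feasB, h.argminB, h.lamBar, h.muBar⟩, h.relax⟩,
    fun ⟨hA, hr, hB, hrel⟩ => ⟨hA.acu, hA.argminA, hr, hr ▸ hA.lam, hB.feasB, hB.argminB,
      hB.lamBar, hB.muBar, hrel⟩⟩

/-! ### Consensus -/

theorem Communicable.eq_of_edge_eq (hG : P.Communicable) {α : Type*} {f : Fin N → α}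
    (hf : ∀ i j, (i, j) ∈ P.E → f i = f j) (i j : Fin N) : f i = f j := by
  obtain ⟨p⟩ := hG.connected.preconnected i j
  induction p with
  | nil => rfl
  | cons h _ ih =>
    rw [SimpleGraph.fromRel_adj] at h
    exact (h.2.elim (hf _ _) fun h => (hf _ _ h).symm).trans ih

theorem IsWeighted.sum_row (hW : P.IsWeighted) (i : Fin N) : ∑ j, P.W i j = 0 := by
  rw [← Finset.add_sum_erase _ _ (Finset.mem_univ i), hW.diag i, neg_add_cancel]

theorem IsWeighted.nonpos (hW : P.IsWeighted) {i j : Fin N} (hij : i ≠ j) : P.W i j ≤ 0 := by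
  by_cases h : (i, j) ∈ P.E
  · exact (hW.neg i j h).le
  · exact (hW.zero i j hij h).le

theorem IsWeighted.eq_of_mulVec_eq_zero (hW : P.IsWeighted) (hG : P.Communicable)
    {u : Fin N → ℝ} (hu : P.W *ᵥ u = 0) (i j : Fin N) : u i = u j := by
  have : Nonempty (Fin N) := ⟨i⟩
  obtain ⟨m, hm⟩ := Finite.exists_max u
  -- Maximum principle: a vertex where `u` is maximal passes the maximum on to its neighbours.
  have hstep (i j : Fin N) (hij : (i, j) ∈ P.E) (hi : u i = u m) : u j = u m := by
    have hsum : ∑ k, P.W i k * (u k - u m) = 0 := by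
      have hrow : ∑ k, P.W i k * u k = 0 := congrFun hu i
      simp only [mul_sub, Finset.sum_sub_distrib, ← Finset.sum_mul, hrow, hW.sum_row, zero_mul,
        sub_zero]
    have hnonneg (k : Fin N) : 0 ≤ P.W i k * (u k - u m) := by
      rcases eq_or_ne i k with rfl | hik
      · rw [hi, sub_self, mul_zero]
      · exact mul_nonneg_of_nonpos_of_nonpos (hW.nonpos hik) (sub_nonpos.2 (hm k))
    have hj := (Finset.sum_eq_zero_iff_of_nonneg fun k _ => hnonneg k).1 hsum j (Finset.mem_univ j)
    exact sub_eq_zero.1 ((mul_eq_zero.1 hj).resolve_left (hW.neg i j hij).ne)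
  have hmax (i : Fin N) : u i = u m :=
    (hG.eq_of_edge_eq (f := fun i => u i = u m)
      (fun i j hij => propext ⟨hstep i j hij, hstep j i (hG.symm i j hij)⟩) i m).mpr rfl
  rw [hmax i, hmax j]

theorem sum_inEdge_tail {M : Type*} [AddCommMonoid M] (i : Fin N) (f : Fin N → M) :
    ∑ e : P.InEdge i, f e.1.1.1 = ∑ j, if (j, i) ∈ P.E then f j else 0 := by
  rw [← Finset.sum_filter]
  refine Finset.sum_bij (fun e _ => e.1.1.1) (fun e _ => ?_) (fun e _ e' _ h => ?_)
    (fun j hj => ?_) (fun _ _ => rfl)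
  · have he : e.1.1 = (e.1.1.1, i) := Prod.ext rfl e.2
    simpa using he ▸ e.1.2
  · exact Subtype.ext (Subtype.ext (Prod.ext h (e.2.trans e'.2.symm)))
  · exact ⟨⟨⟨(j, i), by simpa using hj⟩, rfl⟩, Finset.mem_univ _, rfl⟩

theorem IsWeighted.sum_inEdge_smul (hW : P.IsWeighted) (hG : P.Communicable) (i : Fin N)
    (y : Fin N → Fin l → ℝ) :
    P.W i i • y i + ∑ e : P.InEdge i, P.W e.1.1.1 i • y e.1.1.1 = ∑ j, P.W j i • y j := by
  rw [sum_inEdge_tail i fun j => P.W j i • y j, ← Finset.add_sum_erase _ _ (Finset.mem_univ i),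
    if_neg (hG.no_loops i), zero_add, ← Finset.add_sum_erase _ (fun j => P.W j i • y j)
    (Finset.mem_univ i)]
  congr 1
  refine Finset.sum_congr rfl fun j hj => ?_
  split_ifs with h
  · rfl
  · rw [hW.zero j i (Finset.ne_of_mem_erase hj) h, zero_smul]

theorem IsWeighted.exists_potential (hW : P.IsWeighted) (hG : P.Communicable)
    {v : Fin N → Fin l → ℝ} (hv : ∑ i, v i = 0) :
    ∃ y : Fin N → Fin l → ℝ, ∀ i, v i = ∑ j, P.W j i • y j := by
  obtain ⟨m⟩ := hG.connected.nonempty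
  have hcol (a : Fin l) : ∃ y : Fin N → ℝ, P.Wᵀ *ᵥ y = fun i => v i a := by
    refine exists_transpose_mulVec_eq P.W fun u hu => ?_
    have hu' : u = fun _ => u m := funext fun i => hW.eq_of_mulVec_eq_zero hG hu i m
    have hva : ∑ i, v i a = 0 := by simpa using congrFun hv a
    rw [hu', dotProduct, ← Finset.sum_mul, hva, zero_mul]
  choose y hy using hcol
  refine ⟨fun j a => y a j, fun i => funext fun a => ?_⟩
  simpa [Matrix.mulVec, dotProduct] using (congrFun (hy a) i).symm

/-- The part of the optimality system that does not depend on the objectives: the agents agree on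
`A_i x_i + σ_i`, and every estimate `y_{ji}` is exact. -/
structure InConsensus (ψ : P.State) : Prop where
  agree : ∀ e, disagreement ψ e = 0
  exact_estimate : ∀ e, yEdgePart ψ e = yPart ψ e.1.1

theorem inConsensus_iff {ψ : P.State} : InConsensus ψ ↔
    (∀ e, lamPart (P.linT *ᵥ ψ) e = 0) ∧ ∀ e, muPart (P.linT *ᵥ ψ) e = 0 := by
  simp only [linT_eq, Matrix.add_mulVec, lamPart_add, muPart_add, lamPart_couplingMatrix,
    lamPart_consensusMatrix, muPart_couplingMatrix, muPart_consensusMatrix, add_zero, zero_add,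
    neg_eq_zero, sub_eq_zero]
  exact ⟨fun h => ⟨h.agree, fun e => (h.exact_estimate e).symm⟩,
    fun h => ⟨h.1, fun e => (h.2 e).symm⟩⟩

theorem InConsensus.linT_mulVec_eq_zero {ψ : P.State} (h : InConsensus ψ)
    (hlam : ∀ e, lamPart ψ e = 0) (hmu : ∀ e, muPart ψ e = 0) : P.linT *ᵥ ψ = 0 := by
  have hlamB (i : Fin N) : lamB ψ i = 0 := by simp [lamB, hlam]
  refine state_ext (fun i => ?_) (fun i => ?_) (inConsensus_iff.1 h).1 (fun i => ?_)
    (inConsensus_iff.1 h).2 (fun e => ?_) <;>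
  simp only [linT_eq, Matrix.add_mulVec, xPart_add, sigPart_add, yPart_add, yEdgePart_add,
    xPart_couplingMatrix, sigPart_couplingMatrix, yPart_couplingMatrix, yEdgePart_couplingMatrix,
    xPart_consensusMatrix, sigPart_consensusMatrix, yPart_consensusMatrix,
    yEdgePart_consensusMatrix, hlamB, hmu, Matrix.mulVec_zero, ite_self, Finset.sum_const_zero,
    neg_zero, add_zero] <;> rfl

theorem add_aggregate (x : (i : Fin N) → Fin (n i) → ℝ) (i : Fin N) :
    P.A i *ᵥ x i + P.aggregate x i = ∑ j, P.A j *ᵥ x j :=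
  Finset.add_sum_erase _ (fun j => P.A j *ᵥ x j) (Finset.mem_univ i)

theorem InConsensus.sigPart_eq_aggregate (hG : P.Communicable) (hW : P.IsWeighted) {ψ : P.State}
    (h : InConsensus ψ) (hF : ∀ i, localPart ψ i ∈ P.setF i) :
    sigPart ψ = P.aggregate (xPart ψ) := by
  have hcons : ∀ i j, P.A i *ᵥ xPart ψ i + sigPart ψ i = P.A j *ᵥ xPart ψ j + sigPart ψ j :=
    hG.eq_of_edge_eq (f := fun i => P.A i *ᵥ xPart ψ i + sigPart ψ i) fun i j hij => by
      have hij := h.agree ⟨(i, j), hij⟩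
      rw [disagreement, sub_sub, sub_eq_zero] at hij
      exact hij.symm
  have hF' (i : Fin N) : (N : ℝ) • (P.A i *ᵥ xPart ψ i) -
      (P.A i *ᵥ xPart ψ i + sigPart ψ i) = ∑ j, P.W j i • yPart ψ j := by
    have hi : ((N : ℝ) - 1) • (P.A i *ᵥ xPart ψ i) - sigPart ψ i =
      P.W i i • yPart ψ i + ∑ e : P.InEdge i, P.W e.1.1.1 i • yEdgePart ψ e.1 := hF i
    simp only [h.exact_estimate] at hi
    rw [← hW.sum_inEdge_smul hG, ← hi]
    module
  -- The rows of `W` sum to zero, so summing the constraints `F_i` eliminates `y`.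
  have hsum : ∑ i, ((N : ℝ) • (P.A i *ᵥ xPart ψ i) -
      (P.A i *ᵥ xPart ψ i + sigPart ψ i)) = 0 := by
    simp only [hF']
    rw [Finset.sum_comm]
    simp only [← Finset.sum_smul, hW.sum_row, zero_smul, Finset.sum_const_zero]
  funext i
  have hN : (N : ℝ) ≠ 0 := mod_cast (Fin.pos i).ne'
  simp only [fun j => hcons j i, Finset.sum_sub_distrib, ← Finset.smul_sum, Finset.sum_const,
    Finset.card_univ, Fintype.card_fin, ← Nat.cast_smul_eq_nsmul ℝ, sub_eq_zero] at hsum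
  exact add_left_cancel ((smul_right_injective _ hN hsum).symm.trans (add_aggregate _ i).symm)

theorem sum_sub_aggregate (x : (i : Fin N) → Fin (n i) → ℝ) :
    ∑ i, (((N : ℝ) - 1) • (P.A i *ᵥ x i) - P.aggregate x i) = 0 := by
  have hagg (i : Fin N) : P.aggregate x i = ∑ j, P.A j *ᵥ x j - P.A i *ᵥ x i :=
    eq_sub_of_add_eq' (add_aggregate x i)
  simp only [hagg, Finset.sum_sub_distrib, ← Finset.smul_sum, Finset.sum_const, Finset.card_univ,
    Fintype.card_fin, ← Nat.cast_smul_eq_nsmul ℝ]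
  module

theorem exists_consensus_state (hG : P.Communicable) (hW : P.IsWeighted)
    (x : (i : Fin N) → Fin (n i) → ℝ) :
    ∃ ψ : P.State, xPart ψ = x ∧ sigPart ψ = P.aggregate x ∧ (∀ i, localPart ψ i ∈ P.setF i) ∧
      P.linT *ᵥ ψ = 0 := by
  obtain ⟨y, hy⟩ := hW.exists_potential hG (sum_sub_aggregate x)
  refine ⟨mkState x (P.aggregate x) 0 y 0 (fun e => y e.1.1), rfl, rfl, fun i => ?_,
    InConsensus.linT_mulVec_eq_zero ⟨fun e => ?_, fun _ => rfl⟩ (fun _ => rfl) (fun _ => rfl)⟩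
  · exact (hy i).trans (hW.sum_inEdge_smul hG i y).symm
  · simp only [disagreement, xPart_mkState, sigPart_mkState, add_aggregate, sub_sub, sub_self]

theorem objective_eq_totalCost {ψ : P.State} (h : sigPart ψ = P.aggregate (xPart ψ)) :
    P.objective ψ = P.totalCost (xPart ψ) := by
  simp only [objective, totalCost, h]

theorem exists_mem_localStates_of_mem_feasible (hG : P.Communicable) (hW : P.IsWeighted)
    {x : (i : Fin N) → Fin (n i) → ℝ} (hx : x ∈ P.feasible) :
    ∃ ψ ∈ P.localStates, P.objective ψ = P.totalCost x ∧ P.linT *ᵥ ψ = 0 := by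
  obtain ⟨ψ, rfl, hσ, hF, hT⟩ := exists_consensus_state hG hW x
  refine ⟨ψ, fun i => ⟨hx.1 i, hF i, ?_⟩, objective_eq_totalCost hσ, hT⟩
  change P.A i *ᵥ xPart ψ i + sigPart ψ i ≤ P.c
  rw [hσ, add_aggregate]
  exact hx.2

theorem InConsensus.xPart_mem_feasible (hG : P.Communicable) (hW : P.IsWeighted) {ψ : P.State}
    (h : InConsensus ψ) (hψ : ψ ∈ P.localStates) : xPart ψ ∈ P.feasible := by
  obtain ⟨m⟩ := hG.connected.nonempty
  refine ⟨fun i => (hψ i).1, ?_⟩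
  rw [← add_aggregate _ m, ← h.sigPart_eq_aggregate hG hW fun i => (hψ i).2.1]
  exact (hψ m).2.2

/-! ### Dual components -/

/-- The state obtained by keeping only the components `λ` and `μ` of `ψ`, on which the convex part
of `T` does not depend. -/
def dualState (ψ : P.State) : P.State := mkState 0 0 (lamPart ψ) 0 (muPart ψ) 0

theorem localPart_add_dualState (ψ ν : P.State) :
    localPart (ψ + dualState ν) = localPart ψ := by
  funext i
  simp only [localPart, dualState, xPart_add, sigPart_add, yPart_add, yEdgePart_add, xPart_mkState,
    sigPart_mkState, yPart_mkState, yEdgePart_mkState, Pi.zero_apply, add_zero]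

theorem objective_add_dualState (ψ ν : P.State) :
    P.objective (ψ + dualState ν) = P.objective ψ := by
  change ∑ i, P.J i ((localPart (ψ + dualState ν) i).1, (localPart (ψ + dualState ν) i).2.1) = _
  rw [localPart_add_dualState]
  rfl

theorem iota_localStates_add_dualState (ψ ν : P.State) :
    iota P.localStates (ψ + dualState ν) = iota P.localStates ψ :=
  iota_congr (by simp only [localStates, Set.mem_ofPred_eq, localPart_add_dualState])

theorem convexPart_add_dualState (ψ ν : P.State) :
    P.convexPart (ψ + dualState ν) = P.convexPart ψ := by
  simp only [convexPart_eq, Pi.add_apply, objective_add_dualState, iota_localStates_add_dualState]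

theorem dotProduct_dualState (ψ : P.State) : ψ ⬝ᵥ dualState ψ = dualState ψ ⬝ᵥ dualState ψ := by
  simp only [dotProduct_eq_parts, dualState, xPart_mkState, sigPart_mkState, lamPart_mkState,
    yPart_mkState, muPart_mkState, yEdgePart_mkState, Pi.zero_apply, dotProduct_zero]

theorem dualState_eq_zero_of_mem_subdiff {f : P.State → EReal}
    (hf : ∀ ψ ν, f (ψ + dualState ν) = f ψ) {ψ g : P.State} (hg : g ∈ subdiff f ψ)
    (hψ : f ψ ≠ ⊤) (hψ' : f ψ ≠ ⊥) : dualState g = 0 := by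
  have h := dotProduct_nonpos_of_mem_subdiff hg hψ hψ' (hf ψ g).le
  rw [dotProduct_dualState] at h
  exact dotProduct_self_eq_zero.1
    (h.antisymm (Finset.sum_nonneg fun _ _ => mul_self_nonneg _))

theorem dualState_neg (ψ : P.State) : dualState (-ψ) = -dualState ψ :=
  state_ext (fun _ => neg_zero.symm) (fun _ => neg_zero.symm) (fun _ => rfl)
    (fun _ => neg_zero.symm) (fun _ => rfl) fun _ => neg_zero.symm

theorem dualState_add (ψ ν : P.State) : dualState (ψ + ν) = dualState ψ + dualState ν :=
  state_ext (fun _ => (add_zero 0).symm) (fun _ => (add_zero 0).symm) (fun _ => rfl)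
    (fun _ => (add_zero 0).symm) (fun _ => rfl) fun _ => (add_zero 0).symm

theorem InConsensus.of_dualState_eq_zero {ψ : P.State} (h : dualState (P.linT *ᵥ ψ) = 0) :
    InConsensus ψ :=
  inConsensus_iff.2 ⟨congrFun (congrArg lamPart h), congrFun (congrArg muPart h)⟩

theorem InConsensus.linT_mulVec_dualState {ν : P.State} (h : InConsensus ν) :
    P.linT *ᵥ dualState ν = P.linT *ᵥ ν := by
  have hprimal : InConsensus (ν - dualState ν) := by
    refine ⟨fun e => (?_ : disagreement (ν - dualState ν) e = 0), fun e => ?_⟩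
    · simpa [disagreement_sub, disagreement, dualState] using h.agree e
    · simpa [dualState] using h.exact_estimate e
  have h0 := hprimal.linT_mulVec_eq_zero (fun _ => sub_self _) fun _ => sub_self _
  rw [Matrix.mulVec_sub, sub_eq_zero] at h0
  exact h0.symm

theorem linT_transpose : P.linTᵀ = -P.linT := by
  rw [linT_eq, Matrix.transpose_add, couplingMatrix_transpose, consensusMatrix_transpose, neg_add]

/-! ### Slater's condition -/

variable (P) in
/-- The linear map that sends a state to the arguments of `J_i`. -/
def decisionMap (i : Fin N) : P.State →ₗ[ℝ] (Fin (n i) → ℝ) × (Fin l → ℝ) where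
  toFun ψ := (xPart ψ i, sigPart ψ i)
  map_add' _ _ := rfl
  map_smul' _ _ := rfl

variable (P) in
/-- `localPart` as a linear map. -/
def localMap (i : Fin N) : P.State →ₗ[ℝ] P.Local i where
  toFun ψ := localPart ψ i
  map_add' _ _ := rfl
  map_smul' _ _ := rfl

theorem objective_eq_sum : P.objective = ∑ i, P.J i ∘ P.decisionMap i := by
  funext ψ
  simp only [objective, Finset.sum_apply]
  rfl

theorem convex_epigraph_objective (hJ : ∀ i, IsCCP (P.J i)) :
    Convex ℝ (epigraph P.objective) := by
  rw [objective_eq_sum]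
  exact convex_epigraph_sum _ (fun i _ => convex_epigraph_comp (hJ i).convex_epi _)
    fun i _ _ => (hJ i).ne_bot _

theorem effDom_objective (hJ : ∀ i, IsCCP (P.J i)) :
    effDom P.objective = ⋂ i, P.decisionMap i ⁻¹' effDom (P.J i) := by
  rw [objective_eq_sum]
  exact effDom_sum fun i _ => (hJ i).ne_bot _

variable (P) in
/-- The constraint `x_i ∈ X_i`, dropped if `dom J_i` enforces it anyway. In that case Slater's
condition does not require `x_i` to be relatively interior to `X_i`. -/
def relaxedX (i : Fin N) : Set (Fin (n i) → ℝ) :=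
  {x | effDom (P.J i) ⊆ P.X i ×ˢ Set.univ ∨ x ∈ P.X i}

theorem convex_relaxedX {i : Fin N} (hX : Convex ℝ (P.X i)) : Convex ℝ (P.relaxedX i) := by
  by_cases h : effDom (P.J i) ⊆ P.X i ×ˢ Set.univ
  · simpa only [relaxedX, h, true_or, Set.ofPred_true] using convex_univ
  · simpa only [relaxedX, h, false_or, Set.ofPred_mem_eq] using hX

theorem IsSlaterPoint.mem_relCore_relaxedX {x : (i : Fin N) → Fin (n i) → ℝ}
    (hx : P.IsSlaterPoint x) (i : Fin N) : x i ∈ relCore (P.relaxedX i) := by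
  by_cases h : effDom (P.J i) ⊆ P.X i ×ˢ Set.univ
  · exact ⟨.inl h, fun _ _ => .of_forall fun _ => .inl h⟩
  · have hX : P.relaxedX i = P.X i := by simp only [relaxedX, h, false_or, Set.ofPred_mem_eq]
    rw [hX]
    exact intrinsicInterior_subset_relCore _ ((hx.mem_ri_set i).resolve_left h)

variable (P) in
/-- The states that satisfy all local constraints with `relaxedX` in the place of `X_i`. -/
def relaxedStates : Set P.State :=
  ⋂ i, P.localMap i ⁻¹' P.localConstraint i (P.relaxedX i)

theorem mem_relaxedStates {ψ : P.State} :
    ψ ∈ P.relaxedStates ↔ ∀ i, localPart ψ i ∈ P.localConstraint i (P.relaxedX i) :=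
  Set.mem_iInter

theorem localStates_subset_relaxedStates : P.localStates ⊆ P.relaxedStates := fun _ hψ =>
  mem_relaxedStates.2 fun i => ⟨.inr (hψ i).1, (hψ i).2⟩

theorem mem_localStates_of_mem_relaxedStates (hJ : ∀ i, IsCCP (P.J i)) {ψ : P.State}
    (hψ : ψ ∈ P.relaxedStates) (hdom : P.objective ψ ≠ ⊤) : ψ ∈ P.localStates := fun i => by
  have hi := mem_relaxedStates.1 hψ i
  have hdom' : ψ ∈ effDom P.objective := lt_top_iff_ne_top.2 hdom
  rw [effDom_objective hJ] at hdom'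
  exact ⟨hi.1.elim (fun h => (h (Set.mem_iInter.1 hdom' i)).1) id, hi.2⟩

theorem convex_relaxedStates (hX : ∀ i, Convex ℝ (P.X i)) : Convex ℝ P.relaxedStates :=
  convex_iInter fun i => (convex_localConstraint (convex_relaxedX (hX i))).linear_preimage _

theorem IsSlaterPoint.mem_relCore_effDom_objective (hJ : ∀ i, IsCCP (P.J i)) {ψ : P.State}
    (hx : P.IsSlaterPoint (xPart ψ)) (hσ : sigPart ψ = P.aggregate (xPart ψ)) :
    ψ ∈ relCore (effDom P.objective) := by
  rw [effDom_objective hJ]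
  refine mem_relCore_iInter fun i => mem_relCore_preimage _
    (intrinsicInterior_subset_relCore _ ?_)
  change (xPart ψ i, sigPart ψ i) ∈ _
  rw [hσ]
  exact hx.mem_ri_dom i

theorem IsSlaterPoint.mem_relCore_relaxedStates {ψ : P.State} (hx : P.IsSlaterPoint (xPart ψ))
    (hσ : sigPart ψ = P.aggregate (xPart ψ)) (hF : ∀ i, localPart ψ i ∈ P.setF i) :
    ψ ∈ relCore P.relaxedStates := by
  refine mem_relCore_iInter fun i => mem_relCore_preimage _ ?_
  rw [localConstraint_eq]
  refine mem_relCore_inter (mem_relCore_preimage _ (hx.mem_relCore_relaxedX i))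
    (mem_relCore_inter (mem_relCore_preimage _ ?_) (mem_relCore_preimage _ ?_)) <;>
  refine intrinsicInterior_subset_relCore _ ?_
  · rw [intrinsicInterior_singleton]
    exact mem_setF_iff.1 (hF i)
  · refine interior_subset_intrinsicInterior ?_
    rw [← Set.pi_univ_Iic, interior_pi_set Set.finite_univ]
    intro a _
    change (P.A i *ᵥ xPart ψ i + sigPart ψ i) a ∈ interior (Set.Iic (P.c a))
    rw [interior_Iic, hσ, add_aggregate]
    exact hx.strict a

/-! ### Zeros of `T` -/

theorem totalCost_le_objective (hJ : ∀ i, IsCCP (P.J i)) (hG : P.Communicable)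
    (hW : P.IsWeighted) {x : (i : Fin N) → Fin (n i) → ℝ} (hx : x ∈ P.minimizers) {ψ : P.State}
    (hψ : ψ ∈ P.relaxedStates) (hT : P.linT *ᵥ ψ = 0) : P.totalCost x ≤ P.objective ψ := by
  by_cases htop : P.objective ψ = ⊤
  · exact htop ▸ le_top
  have hloc := mem_localStates_of_mem_relaxedStates hJ hψ htop
  have hcons : InConsensus ψ :=
    inConsensus_iff.2 ⟨fun _ => by rw [hT]; rfl, fun _ => by rw [hT]; rfl⟩
  rw [objective_eq_totalCost (hcons.sigPart_eq_aggregate hG hW fun i => (hloc i).2.1)]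
  exact hx.2.2 _ (hcons.xPart_mem_feasible hG hW hloc)

theorem exists_multiplier (hJ : ∀ i, IsCCP (P.J i)) (hX : P.FeasibleSetsRegular)
    (hmin : P.minimizers.Nonempty) (hG : P.Communicable) (hW : P.IsWeighted) :
    ∃ z ∈ P.localStates, P.objective z ≠ ⊤ ∧ P.linT *ᵥ z = 0 ∧ ∃ g₁ ∈ subdiff P.objective z,
      ∃ g₂ ∈ subdiff (iota P.localStates) z, ∃ ν, P.linT *ᵥ ν = -(g₁ + g₂) := by
  obtain ⟨x, hx⟩ := hmin
  obtain ⟨z, hz, hzx, hzT⟩ := exists_mem_localStates_of_mem_feasible hG hW hx.1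
  obtain ⟨xb, hxb⟩ := hX.slater
  obtain ⟨b, rfl, hbσ, hbF, hbT⟩ := exists_consensus_state hG hW xb
  have hz' := localStates_subset_relaxedStates hz
  have hztop : P.objective z ≠ ⊤ := hzx ▸ hx.2.1.ne
  have hzle (w : P.State) (hw : w - z ∈ LinearMap.ker P.linT.mulVecLin) :
      P.objective z + iota P.relaxedStates z ≤ P.objective w + iota P.relaxedStates w := by
    rw [LinearMap.mem_ker, Matrix.mulVecLin_apply, Matrix.mulVec_sub, hzT, sub_zero] at hw
    by_cases hwS : w ∈ P.relaxedStates
    · rw [iota_of_mem hz', iota_of_mem hwS, hzx]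
      exact add_le_add_left (totalCost_le_objective hJ hG hW hx hwS hw) 0
    · rw [iota_of_notMem hwS, EReal.add_top_of_ne_bot (objective_ne_bot hJ w)]
      exact le_top
  obtain ⟨g₁, hg₁, g₂, hg₂, hker⟩ := exists_mem_subdiff_of_min_add (convex_epigraph_objective hJ)
    (convex_epigraph_iota (convex_relaxedStates hX.convex)) (objective_ne_bot hJ) (iota_ne_bot _)
    hztop (by simp [iota_of_mem hz']) hzle (b := b)
    (by simp [Matrix.mulVec_sub, hbT, hzT]) (hxb.mem_relCore_effDom_objective hJ hbσ)
    (by rw [effDom_iota]; exact hxb.mem_relCore_relaxedStates hbσ hbF)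
  obtain ⟨ν, hν⟩ := exists_transpose_mulVec_eq P.linT hker
  refine ⟨z, hz, hztop, hzT, g₁, hg₁, g₂,
    subdiff_iota_anti localStates_subset_relaxedStates hz hg₂, ν, ?_⟩
  rw [← hν, linT_transpose, Matrix.neg_mulVec, neg_neg]

theorem exists_zero (hJ : ∀ i, IsCCP (P.J i)) (hX : P.FeasibleSetsRegular)
    (hmin : P.minimizers.Nonempty) (hG : P.Communicable) (hW : P.IsWeighted) :
    ∃ p, ∃ g ∈ P.opA p, -g ∈ P.opB p := by
  obtain ⟨z, hz, hztop, hzT, g₁, hg₁, g₂, hg₂, ν, hν⟩ := exists_multiplier hJ hX hmin hG hW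
  have hcons : InConsensus ν := .of_dualState_eq_zero (by
    rw [hν, dualState_neg, dualState_add,
      dualState_eq_zero_of_mem_subdiff objective_add_dualState hg₁ hztop (objective_ne_bot hJ z),
      dualState_eq_zero_of_mem_subdiff iota_localStates_add_dualState hg₂
        (by simp [iota_of_mem hz]) (iota_ne_bot _ z), add_zero, neg_zero])
  have hp : P.linT *ᵥ (z + dualState ν) = -(g₁ + g₂) := by
    rw [Matrix.mulVec_add, hzT, zero_add, hcons.linT_mulVec_dualState, hν]
  let M : Matrix P.Idx P.Idx ℝ := (1 / 2 : ℝ) • P.couplingMatrix + P.consensusMatrix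
  refine ⟨z + dualState ν, g₁ + M *ᵥ (z + dualState ν), ?_, ?_⟩
  · rw [opA, mem_subdiffAdd, add_sub_cancel_right]
    exact mem_subdiff_add_of_invariant (objective_add_dualState · ν) hg₁
  · have hg : -(g₁ + M *ᵥ (z + dualState ν)) -
        ((1 / 2 : ℝ) • P.couplingMatrix) *ᵥ (z + dualState ν) = g₂ := by
      rw [linT_eq, Matrix.add_mulVec, ← neg_eq_iff_eq_neg, ← sub_eq_iff_eq_add'] at hp
      rw [← hp]
      simp only [M, Matrix.add_mulVec, Matrix.smul_mulVec]
      module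
    rw [opB, mem_subdiffAdd, hg]
    exact mem_subdiff_add_of_invariant (iota_localStates_add_dualState · ν) hg₂

theorem convexPart_of_mem_localStates {ψ : P.State} (hψ : ψ ∈ P.localStates) :
    P.convexPart ψ = P.objective ψ := by
  rw [convexPart_eq, Pi.add_apply, iota_of_mem hψ, add_zero]

theorem xPart_mem_minimizers_of_mem_zer (hJ : ∀ i, IsCCP (P.J i)) (hG : P.Communicable)
    (hW : P.IsWeighted) (hfeas : ∃ x ∈ P.feasible, P.totalCost x ≠ ⊤) {ψ : P.State}
    (hψ : ψ ∈ zer P.opT) : xPart ψ ∈ P.minimizers := by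
  obtain ⟨g, hg, hgψ⟩ := hψ
  have hconsensus (x : (i : Fin N) → Fin (n i) → ℝ) (hx : x ∈ P.feasible) :
      ∃ w, P.convexPart w = P.totalCost x ∧ P.linT *ᵥ w = 0 := by
    obtain ⟨w, hw, hwx, hwT⟩ := exists_mem_localStates_of_mem_feasible hG hW hx
    exact ⟨w, (convexPart_of_mem_localStates hw).trans hwx, hwT⟩
  have htop : P.convexPart ψ ≠ ⊤ := by
    obtain ⟨x, hx, hxtop⟩ := hfeas
    obtain ⟨w, hwx, -⟩ := hconsensus x hx
    exact ne_top_of_mem_subdiff ⟨w, hwx ▸ hxtop⟩ hg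
  have hiota : iota P.localStates ψ ≠ ⊤ := ((EReal.add_ne_top_iff_ne_top₂ (objective_ne_bot hJ ψ)
    (iota_ne_bot P.localStates ψ)).1 (by rwa [convexPart_eq] at htop)).2
  have hloc : ψ ∈ P.localStates := not_not.1 fun h => hiota (iota_of_notMem h)
  have hbot : P.convexPart ψ ≠ ⊥ :=
    (convexPart_of_mem_localStates hloc).trans_ne (objective_ne_bot hJ ψ)
  have hgT : P.linT *ᵥ ψ = -g := (neg_eq_of_add_eq_zero_right hgψ.symm).symm
  have hcons : InConsensus ψ := .of_dualState_eq_zero (by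
    rw [hgT, dualState_neg,
      dualState_eq_zero_of_mem_subdiff convexPart_add_dualState hg htop hbot, neg_zero])
  have hcost : P.convexPart ψ = P.totalCost (xPart ψ) :=
    (convexPart_of_mem_localStates hloc).trans
      (objective_eq_totalCost (hcons.sigPart_eq_aggregate hG hW fun i => (hloc i).2.1))
  refine ⟨hcons.xPart_mem_feasible hG hW hloc, lt_top_iff_ne_top.2 (hcost ▸ htop), fun x hx => ?_⟩
  obtain ⟨w, hwx, hwT⟩ := hconsensus x hx
  -- On the kernel of the linear part, skew-symmetry makes the subgradient inequality trivial.
  have horth : g ⬝ᵥ (w - ψ) = 0 := by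
    rw [← neg_neg g, ← hgT, ← zero_sub, ← hwT, ← Matrix.mulVec_sub, dotProduct_comm]
    exact dotProduct_mulVec_self_of_skew linT_transpose _
  simpa only [horth, EReal.coe_zero, add_zero, hcost, hwx] using hg w

/-! ### Convergence of the algorithm -/

theorem exists_isGenerated (hJ : ∀ i, IsCCP (P.J i)) (hX : P.FeasibleSetsRegular)
    (hne : ∀ i, (P.localFeasB i).Nonempty) (τ : P.StepSizes) (γ : ℕ → ℝ) (ψ0 : P.State) :
    ∃ ψ, IsGenerated τ γ ψ0 ψ := by
  choose a ha using exists_firstStep hJ τ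
  choose b hb using exists_secondStep hX hne τ
  let reflect (z : P.State) : P.State := (2 : ℝ) • a z - z
  let ψt (k : ℕ) : P.State := k.rec ψ0 fun k z => z + (2 * γ k) • (b (reflect z) - a z)
  exact ⟨fun k => a (ψt (k - 1)), ψt, fun k => reflect (ψt (k - 1)),
    fun k => b (reflect (ψt (k - 1))), rfl,
    fun _ => iteration_iff.2 ⟨ha _, rfl, hb _, rfl⟩⟩

theorem IsGenerated.tendsto (hJ : ∀ i, IsCCP (P.J i)) (hX : P.FeasibleSetsRegular)
    (hne : P.localStates.Nonempty) (hzero : ∃ p, ∃ g ∈ P.opA p, -g ∈ P.opB p) {τ : P.StepSizes}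
    (hΦ : (designMatrix τ).PosDef) {γ : ℕ → ℝ} (hγ : ∀ k, γ k ∈ Set.Icc (0 : ℝ) 1)
    (hγsum : Tendsto (fun m => ∑ k ∈ Finset.range m, γ k * (1 - γ k)) atTop atTop)
    {ψ0 : P.State} {ψ : ℕ → P.State} (h : IsGenerated τ γ ψ0 ψ) :
    ∃ ψs ∈ zer P.opT, Tendsto ψ atTop (𝓝 ψs) := by
  obtain ⟨ψt, ψh, ψb, -, hiter⟩ := h
  have hit := fun k => iteration_iff.1 (hiter k)
  have hfeas : ∀ i, (P.localFeasB i).Nonempty := fun i => hne.elim fun _ hψ => ⟨_, hψ i⟩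
  obtain ⟨p, ⟨g, hA, hB⟩, hlim⟩ := tendsto_relaxed_splitting hΦ (isMonotoneOp_opA hJ)
    (isMonotoneOp_opB hne)
    (fun z => (exists_firstStep hJ τ z).imp fun _ h => h.mem_opA hJ)
    (fun z => (exists_secondStep hX hfeas τ z).imp fun _ h => h.mem_opB hX)
    hzero hγ hγsum (u := fun k => ψ (k + 1)) (v := fun k => ψb (k + 1))
    (fun k => (hit k).1.mem_opA hJ) (fun k => by
      obtain ⟨-, hreflect, hsecond, -⟩ := hit k
      exact hreflect ▸ hsecond.mem_opB hX) fun k => (hit k).2.2.2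
  exact ⟨p, mem_zer_opT_of_mem hA hB, (tendsto_add_atTop_iff_nat 1).1 hlim⟩

theorem continuous_xPart : Continuous (xPart : P.State → (i : Fin N) → Fin (n i) → ℝ) := by
  unfold xPart
  fun_prop

end Network

end

theorem theorem2 {N l : ℕ} {n : Fin N → ℕ} (P : Network N l n)
    (hJ : ∀ i, IsCCP (P.J i))
    (hX : P.FeasibleSetsRegular)
    (hmin : P.minimizers.Nonempty)
    (hG : P.Communicable)
    (hW : P.IsWeighted)
    (τ : P.StepSizes)
    (hΦ : (Network.designMatrix τ).PosDef)
    (γ : ℕ → ℝ)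
    (hγ : ∀ k, γ k ∈ Set.Icc (0 : ℝ) 1)
    (hγsum : Tendsto (fun m => ∑ k ∈ Finset.range m, γ k * (1 - γ k)) atTop atTop)
    (ψ0 : P.State) :
    (∃ ψ : ℕ → P.State, Network.IsGenerated τ γ ψ0 ψ) ∧
    ∀ ψ : ℕ → P.State, Network.IsGenerated τ γ ψ0 ψ →
      ∃ ψs ∈ zer P.opT,
        Tendsto ψ atTop (𝓝 ψs) ∧
        Tendsto (fun k => Network.xPart (ψ k)) atTop (𝓝 (Network.xPart ψs)) ∧
        Network.xPart ψs ∈ P.minimizers := by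
  have ⟨x, hx⟩ := hmin
  obtain ⟨ψ₁, hψ₁, -⟩ := Network.exists_mem_localStates_of_mem_feasible hG hW hx.1
  have hzero := Network.exists_zero hJ hX hmin hG hW
  refine ⟨Network.exists_isGenerated hJ hX (fun i => ⟨_, hψ₁ i⟩) τ γ ψ0, fun ψ hψ => ?_⟩
  obtain ⟨ψs, hψs, hlim⟩ := hψ.tendsto hJ hX ⟨ψ₁, hψ₁⟩ hzero hΦ hγ hγsum
  exact ⟨ψs, hψs, hlim, (Network.continuous_xPart.tendsto ψs).comp hlim,
    Network.xPart_mem_minimizers_of_mem_zer hJ hG hW ⟨x, hx.1, hx.2.1.ne⟩ hψs⟩
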